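/- **Conventions.** A *one-dimensional manifold* is a topological space $M$ (not assumed Hausdorff or second countable) in which every point has an open neighbourhood $U$ with an open embedding (a *chart*) $U\to[0,1)$. A point is a *boundary point* if some chart defined on an open neighbourhood of it sends it to $0$; $\partial M$ is the set of boundary points. Points $x,y\in M$ are *inseparable* if every neighbourhood of $x$ meets every neighbourhood of $y$; $x$ is a *branch point* if it is inseparable from some $y\neq x$, and $\mathrm{Br}(M)$ is the set of branch points. Points $x,y$ are *chain inseparable*, written $x\sim y$, if there is a finite sequence $x=x_0,x_1,\dots,x_k=y$ in $M$ with $x_i$ inseparable from $x_{i+1}$ for all $i<k$. This is an equivalence relation; $\pi\colon M\to X=M/{\sim}$ is the quotient map, and $X$ has the quotient topology. A one-dimensional manifold $M$ is *graph-like* if (1) the set $\mathrm{Br}(M)\cup\partial M$ is locally finite, i.e. every point of $M$ has a neighbourhood meeting it in a finite set, and (2) every connected component of $M\setminus(\mathrm{Br}(M)\cup\partial M)$ has a countable base. Let $\Lambda$ be a discrete space, $P\subseteq\{0,1\}\times\Lambda$ any set, $E=([0,1]\times\Lambda)\setminus P$ and $\partial E=E\cap(\{0,1\}\times\Lambda)$.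 An *open one-dimensional CW complex* (or open topological graph) is a quotient space of such an $E$ by an equivalence relation on $\partial E$, extended to $E$ so that each point of $E\setminus\partial E$ is equivalent only to itself; its *vertices* are the classes of the points of $\partial E$. A space $X$ is an open one-dimensional CW complex with vertex set $V\subseteq X$ if there is a homeomorphism from such a quotient onto $X$ that carries its set of vertices onto $V$. **Theorem 1.2.** Let $M$ be a connected graph-like one-dimensional manifold that is not homeomorphic to the circle $S^1$, and let $\pi\colon M\to X=M/{\sim}$ be the quotient map onto the space of chain inseparability classes. Then $X$ is an open one-dimensional CW complex with vertex set $\pi(\mathrm{Br}(M)\cup\partial M)$. Moreover, $X$ is the minimal Hausdorff quotient of $M$: $X$ is Hausdorff, and for every Hausdorff space $B$ and every continuous map $f\colon M\to B$ there is a unique continuous map $\hat f\colon X\to B$ with $\hat f\circ\pi=f$. -/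

import Mathlib

open Set Topology

universe u v

namespace OneManifold

/-! ### Inseparable points, branch points, chain inseparability -/

section Branch

variable {M : Type u} [TopologicalSpace M]

/-- `x` and `y` are inseparable (by open neighbourhoods): every neighbourhood of `x` meets every
neighbourhood of `y`. (This is not Mathlib's `Inseparable`, which means `𝓝 x = 𝓝 y`.) -/
def NbhdInseparable (x y : M) : Prop :=
  ∀ U ∈ 𝓝 x, ∀ V ∈ 𝓝 y, (U ∩ V).Nonempty

theorem NbhdInseparable.symm {x y : M} (h : NbhdInseparable x y) : NbhdInseparable y x :=
  fun U hU V hV => by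
    rw [inter_comm]
    exact h V hV U hU

variable (M) in
/-- The set of branch points: points inseparable from some other point. -/
def branchPoints : Set M := {x | ∃ y, y ≠ x ∧ NbhdInseparable x y}

/-- `x` and `y` are chain inseparable: there is a finite sequence `x = x₀, x₁, …, x_k = y` in which
consecutive points are inseparable. -/
def ChainInseparable (x y : M) : Prop :=
  Relation.ReflTransGen (NbhdInseparable (M := M)) x y

theorem ChainInseparable.symm {x y : M} (h : ChainInseparable x y) : ChainInseparable y x := by
  induction h with
  | refl => exact Relation.ReflTransGen.refl
  | tail _ h ih => exact Relation.ReflTransGen.head h.symm ih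

variable (M) in
/-- Chain inseparability as an equivalence relation. -/
def chainSetoid : Setoid M where
  r := ChainInseparable
  iseqv := ⟨fun _ => Relation.ReflTransGen.refl, ChainInseparable.symm,
    fun h₁ h₂ => Relation.ReflTransGen.trans h₁ h₂⟩

variable (M) in
/-- The space of chain inseparability classes; it carries the quotient topology. -/
abbrev ChainQuotient : Type u := Quotient (chainSetoid M)

variable (M) in
/-- The quotient map `M → M / (chain inseparability)`. -/
def chainProj : M → ChainQuotient M := Quotient.mk (chainSetoid M)

end Branch

/-! ### One-dimensional manifolds -/

/-- A one-dimensional manifold (possibly with boundary, not necessarily Hausdorff or second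
countable): every point has an open neighbourhood with an open embedding into `[0, 1)`. -/
def IsOneManifold (M : Type u) [TopologicalSpace M] : Prop :=
  ∀ x : M, ∃ U : Set M, IsOpen U ∧ x ∈ U ∧ ∃ φ : U → Ico (0 : ℝ) 1, IsOpenEmbedding φ

/-- The boundary: points sent to `0` by a chart, i.e. by an open embedding into `[0, 1)` of an open
neighbourhood of the point. -/
def boundary (M : Type u) [TopologicalSpace M] : Set M :=
  {x | ∃ U : Set M, IsOpen U ∧ ∃ hx : x ∈ U, ∃ φ : U → Ico (0 : ℝ) 1,
    IsOpenEmbedding φ ∧ (φ ⟨x, hx⟩ : ℝ) = 0}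

/-- The set of all branch points and all boundary points. -/
def singularSet (M : Type u) [TopologicalSpace M] : Set M := branchPoints M ∪ boundary M

/-- A subset is locally finite if every point of the space has a neighbourhood whose intersection
with the subset is finite. -/
def LocallyFiniteSet {M : Type u} [TopologicalSpace M] (A : Set M) : Prop :=
  ∀ x : M, ∃ U ∈ 𝓝 x, (U ∩ A).Finite

/-- A one-dimensional manifold is graph-like if the set of its branch and boundary points is
locally finite and every connected component of the complement of this set has a countable base. -/
structure IsGraphLike (M : Type u) [TopologicalSpace M] : Prop where
  isOneManifold : IsOneManifold M
  locallyFinite : LocallyFiniteSet (singularSet M)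
  countableBase : ∀ x ∈ (singularSet M)ᶜ,
    SecondCountableTopology (connectedComponentIn (singularSet M)ᶜ x)

/-! ### Open one-dimensional CW complexes -/

section Graph

/-- The set `{0, 1} × Λ` of the endpoints of the segments of `[0, 1] × Λ`. -/
def endpoints (Λ : Type u) : Set (unitInterval × Λ) := {p | p.1 = 0 ∨ p.1 = 1}

variable {Λ : Type u}

/-- `E = ([0, 1] × Λ) \ P`, where `P` is a set of removed endpoints. -/
abbrev Segments (P : Set (unitInterval × Λ)) : Type u := {p : unitInterval × Λ // p ∉ P}

/-- The boundary `∂E = E ∩ ({0, 1} × Λ)`. -/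
def segBoundary (P : Set (unitInterval × Λ)) : Set (Segments P) := {e | e.1 ∈ endpoints Λ}

/-- The extension of an equivalence relation on `∂E` to `E`, every point of `E \ ∂E` being
equivalent only to itself. -/
def extendSetoid (P : Set (unitInterval × Λ)) (r : Setoid (segBoundary P)) :
    Setoid (Segments P) where
  r a b := a = b ∨ ∃ (ha : a ∈ segBoundary P) (hb : b ∈ segBoundary P), r ⟨a, ha⟩ ⟨b, hb⟩
  iseqv :=
    { refl := fun _ => Or.inl rfl
      symm := by
        rintro a b (h | ⟨ha, hb, h⟩)
        · exact Or.inl h.symm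
        · exact Or.inr ⟨hb, ha, r.symm h⟩
      trans := by
        rintro a b c (rfl | ⟨ha, hb, h⟩) (rfl | ⟨hb', hc, h'⟩)
        · exact Or.inl rfl
        · exact Or.inr ⟨hb', hc, h'⟩
        · exact Or.inr ⟨ha, hb, h⟩
        · exact Or.inr ⟨ha, hc, r.trans h h'⟩ }

/-- The open topological graph obtained from `E` by gluing endpoints according to `r`; when `Λ` is
a discrete space, `E` has the subspace topology of `[0, 1] × Λ` and this is its quotient. -/
abbrev OpenGraph (P : Set (unitInterval × Λ)) (r : Setoid (segBoundary P)) : Type u :=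
  Quotient (extendSetoid P r)

/-- The vertices (`0`-cells): the classes of the points of `∂E`. -/
def OpenGraph.vertices (P : Set (unitInterval × Λ)) (r : Setoid (segBoundary P)) :
    Set (OpenGraph P r) :=
  Quotient.mk (extendSetoid P r) '' segBoundary P

end Graph

/-- `X` is an open one-dimensional CW complex (an open topological graph) with vertex set `V`:
there is a homeomorphism onto `X` from an open topological graph, built from a discrete set `Λ` of
segments, which carries the set of vertices onto `V`. -/
def IsOpenCWComplexWithVertices (X : Type u) [TopologicalSpace X] (V : Set X) : Prop :=
  ∃ (Λ : Type u) (_ : TopologicalSpace Λ) (_ : DiscreteTopology Λ)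
    (P : Set (unitInterval × Λ)) (_ : P ⊆ endpoints Λ) (r : Setoid (segBoundary P))
    (ξ : OpenGraph P r ≃ₜ X), ξ '' OpenGraph.vertices P r = V

end OneManifold

namespace OneManifold

open Filter

/-! ### Curves running out of an arc -/

section Ends

variable {Z : Type*} [TopologicalSpace Z]

/-! A nonsingular point is inseparable only from itself. So each component of the complement of the
singular set (an edge) is a connected, second countable, Hausdorff one-manifold without boundary,
that is, a circle or an open interval. A circle would be compact, hence closed in `M`, and also
open, hence all of `M`, which is excluded. Every edge is therefore an open arc
(`nonempty_arcParam`).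

Near a singular point `y`, local finiteness leaves one or two arcs issuing from `y` whose other
points are nonsingular. Such an arc stays in one edge and cannot accumulate inside it, since its
limit `y` can be separated from every point of the edge. So it runs out to an end of the edge, and
that end converges to `y` (`tendsto_end`, `exists_two_ends`). An end may converge to several points,
but these are inseparable and form part of a single class. Sending each parameter to the class of
the limit there gives a map from the segments, with the nonconvergent ends removed, onto `X`. It
identifies only endpoints, and it is a quotient map because the arcs at a singular point fill up a
neighbourhood (`isQuotientMap_segmentsToChain`). This is the CW structure. Real functions on the
segments that respect the gluing separate the points of `X`, and a map to a Hausdorff space cannot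
distinguish inseparable points.

The classification of the edges rests on Zorn's lemma for injective real coordinates on connected
open sets. Their oscillation is controlled by a bounded set function, strictly monotone on open
sets, obtained from a countable base. Boundedness keeps the coordinates bounded, and strictness
always leaves room to extend. A maximal coordinate is therefore global, or its domain closes up to a
circle. -/

theorem nbhdInseparable_of_tendsto {ι : Type*} {l : Filter ι} [l.NeBot] {f : ι → Z} {x y : Z}
    (hx : Tendsto f l (𝓝 x)) (hy : Tendsto f l (𝓝 y)) : NbhdInseparable x y := by
  intro U hU V hV
  obtain ⟨i, hi, hi'⟩ := ((hx.eventually_mem hU).and (hy.eventually_mem hV)).exists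
  exact ⟨f i, hi, hi'⟩

/-- By monotonicity `g ∘ γ` tends to its infimum `L`. If `L` were larger than `a`, then `γ` would
converge both to `k L` and to `γ 0`, making these inseparable. Once `L = a`, the intermediate value
theorem shows that `k` near `a` takes only values that `γ` takes near `0`. -/
theorem tendsto_end_of_strictMonoOn {k : ℝ → Z} {g : Z → ℝ} {a b : ℝ}
    (hk : ContinuousOn k (Ioo a b)) (hg : ∀ s ∈ Ioo a b, g (k s) = s) {γ : ℝ → Z} {ε : ℝ}
    (hε : 0 < ε) (hγ : ContinuousOn γ (Ico 0 ε)) (hmem : MapsTo γ (Ioo 0 ε) (k '' Ioo a b))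
    (hgγ : ContinuousOn (g ∘ γ) (Ioo 0 ε)) (hmono : StrictMonoOn (g ∘ γ) (Ioo 0 ε))
    (hsep : ∀ w ∈ k '' Ioo a b, ¬ NbhdInseparable w (γ 0)) :
    Tendsto (g ∘ γ) (𝓝[>] 0) (𝓝 a) ∧ Tendsto k (𝓝[>] a) (𝓝 (γ 0)) := by
  have hmem' : ∀ t ∈ Ioo 0 ε, g (γ t) ∈ Ioo a b ∧ k (g (γ t)) = γ t := by
    intro t ht
    obtain ⟨s, hs, hst⟩ := hmem ht
    rw [← hst, hg s hs]
    exact ⟨hs, rfl⟩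
  have hne : (Ioo 0 ε).Nonempty := nonempty_Ioo.2 hε
  have hbdd : BddBelow ((g ∘ γ) '' Ioo 0 ε) := by
    refine ⟨a, ?_⟩
    rintro _ ⟨t, ht, rfl⟩
    exact (hmem' t ht).1.1.le
  have hlim := hmono.monotoneOn.tendsto_nhdsWithin_Ioo_right hne hbdd
  have hγ0 : Tendsto γ (𝓝[>] 0) (𝓝 (γ 0)) :=
    (hγ 0 ⟨le_rfl, hε⟩).mono_left <|
      nhdsWithin_le_of_mem <| mem_of_superset (Ioo_mem_nhdsGT hε) Ioo_subset_Ico_self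
  have hIoo : ∀ᶠ t in 𝓝[>] (0 : ℝ), t ∈ Ioo 0 ε := Ioo_mem_nhdsGT hε
  have hLa : sInf ((g ∘ γ) '' Ioo 0 ε) = a := by
    have hle : a ≤ sInf ((g ∘ γ) '' Ioo 0 ε) := by
      apply le_csInf (hne.image _)
      rintro _ ⟨t, ht, rfl⟩
      exact (hmem' t ht).1.1.le
    by_contra hne'
    have hlt : a < sInf ((g ∘ γ) '' Ioo 0 ε) := lt_of_le_of_ne hle (Ne.symm hne')
    obtain ⟨t, ht⟩ := hne
    have hL : sInf ((g ∘ γ) '' Ioo 0 ε) ∈ Ioo a b :=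
      ⟨hlt, (csInf_le hbdd ⟨t, ht, rfl⟩).trans_lt (hmem' t ht).1.2⟩
    refine hsep _ ⟨_, hL, rfl⟩ (nbhdInseparable_of_tendsto (l := 𝓝[>] (0 : ℝ)) (f := γ) ?_ hγ0)
    refine (((hk.continuousAt (Ioo_mem_nhds hL.1 hL.2)).tendsto).comp hlim).congr' ?_
    filter_upwards [hIoo] with t ht using (hmem' t ht).2
  rw [hLa] at hlim
  refine ⟨hlim, ?_⟩
  intro N hN
  have hev : ∀ᶠ t in 𝓝[>] (0 : ℝ), γ t ∈ N := hγ0 hN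
  obtain ⟨r, hr, hrN⟩ := mem_nhdsGT_iff_exists_Ioo_subset.1 hev
  have hr : 0 < r := hr
  set t₀ := min r ε / 2 with ht₀
  have hmin : 0 < min r ε := lt_min hr hε
  have ht₀' : 0 < t₀ ∧ t₀ < r ∧ t₀ < ε :=
    ⟨by positivity, (half_lt_self hmin).trans_le (min_le_left _ _),
      (half_lt_self hmin).trans_le (min_le_right _ _)⟩
  have hmt := hmem' t₀ ⟨ht₀'.1, ht₀'.2.2⟩
  refine mem_map.2 (mem_of_superset (Ioo_mem_nhdsGT hmt.1.1) ?_)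
  intro s hs
  have hex : ∀ᶠ t in 𝓝[>] (0 : ℝ), g (γ t) < s ∧ t ∈ Ioo 0 t₀ :=
    (hlim.eventually (gt_mem_nhds hs.1)).and (Ioo_mem_nhdsGT ht₀'.1)
  obtain ⟨t₁, hts, ht₁⟩ := hex.exists
  have hsub : Icc t₁ t₀ ⊆ Ioo 0 ε :=
    fun t ht => ⟨ht₁.1.trans_le ht.1, ht.2.trans_lt ht₀'.2.2⟩
  obtain ⟨t, ht, hts'⟩ := intermediate_value_Icc ht₁.2.le (hgγ.mono hsub) ⟨hts.le, hs.2.le⟩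
  have hkt := (hmem' t (hsub ht)).2
  change g (γ t) = s at hts'
  rw [hts'] at hkt
  change k s ∈ N
  rw [hkt]
  exact hrN ⟨(hsub ht).1, ht.2.trans_lt ht₀'.2.1⟩

/-- A curve that starts at a point `γ 0` which can be separated from all points of the arc
`k '' Ioo a b`, and that then stays in this arc, converges to one of the two ends of the arc, and
this end converges to `γ 0`. -/
theorem tendsto_end {k : ℝ → Z} {g : Z → ℝ} {a b : ℝ}
    (hk : ContinuousOn k (Ioo a b)) (hg : ∀ s ∈ Ioo a b, g (k s) = s)
    (hgc : ContinuousOn g (k '' Ioo a b)) {γ : ℝ → Z} {ε : ℝ}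
    (hε : 0 < ε) (hγ : ContinuousOn γ (Ico 0 ε)) (hinj : InjOn γ (Ioo 0 ε))
    (hmem : MapsTo γ (Ioo 0 ε) (k '' Ioo a b))
    (hsep : ∀ w ∈ k '' Ioo a b, ¬ NbhdInseparable w (γ 0)) :
    (Tendsto (g ∘ γ) (𝓝[>] 0) (𝓝 a) ∧ Tendsto k (𝓝[>] a) (𝓝 (γ 0))) ∨
      (Tendsto (g ∘ γ) (𝓝[>] 0) (𝓝 b) ∧ Tendsto k (𝓝[<] b) (𝓝 (γ 0))) := by
  have hgγ : ContinuousOn (g ∘ γ) (Ioo 0 ε) := hgc.comp (hγ.mono Ioo_subset_Ico_self) hmem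
  have hgi : InjOn g (k '' Ioo a b) := by
    rintro _ ⟨s, hs, rfl⟩ _ ⟨t, ht, rfl⟩ h
    rw [hg s hs, hg t ht] at h
    rw [h]
  rcases hgγ.strictMonoOn_of_injOn_Ioo hε (hgi.comp hinj hmem) with hmono | hanti
  · exact Or.inl (tendsto_end_of_strictMonoOn hk hg hε hγ hmem hgγ hmono hsep)
  · right
    -- The decreasing case is the increasing one for the arc traversed backwards.
    have himg : (fun s => k (-s)) '' Ioo (-b) (-a) = k '' Ioo a b := by
      rw [← image_image k (fun s : ℝ => -s), image_neg_eq_neg, neg_Ioo, neg_neg, neg_neg]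
    have hneg : MapsTo (fun s : ℝ => -s) (Ioo (-b) (-a)) (Ioo a b) :=
      fun s hs => ⟨by linarith [hs.2], by linarith [hs.1]⟩
    have h := tendsto_end_of_strictMonoOn (k := fun s => k (-s)) (g := fun z => -g z)
      (a := -b) (b := -a) (hk.comp continuous_neg.continuousOn hneg)
      (fun s hs => by rw [hg _ (hneg hs), neg_neg]) hε hγ (by rwa [himg]) hgγ.neg
      (fun s hs t ht hst => neg_lt_neg (hanti hs ht hst)) (by rwa [himg])
    constructor
    · have := h.1.neg
      simpa [Function.comp_def] using this
    · have h2 : Tendsto (fun s : ℝ => -s) (𝓝[<] b) (𝓝[>] (-b)) := tendsto_neg_nhdsLT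
      simpa [Function.comp_def] using h.2.comp h2

end Ends

/-! ### Connected Hausdorff one-dimensional manifolds without boundary -/

section LocallyReal

variable {Y : Type*} [TopologicalSpace Y]

/-- Every point has an open neighbourhood homeomorphic to the real line. -/
def LocallyReal (Y : Type*) [TopologicalSpace Y] : Prop :=
  ∀ y : Y, ∃ h : ℝ → Y, IsOpenEmbedding h ∧ h 0 = y

/-- One-dimensional invariance of domain: in a chart the function is injective and continuous on an
interval, hence strictly monotone, and the intermediate value theorem fills a neighbourhood of the
value. -/
theorem LocallyReal.isOpen_image (hY : LocallyReal Y) {W : Set Y} {g : Y → ℝ}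
    (hg : ContinuousOn g W) (hi : InjOn g W) {V : Set Y} (hV : IsOpen V) (hVW : V ⊆ W) :
    IsOpen (g '' V) := by
  rw [isOpen_iff_mem_nhds]
  rintro _ ⟨y, hy, rfl⟩
  obtain ⟨h, hh, rfl⟩ := hY y
  obtain ⟨ε, hε, hball⟩ := Metric.isOpen_iff.1 (hV.preimage hh.continuous) 0 hy
  have hsub : MapsTo h (Icc (-(ε / 2)) (ε / 2)) V := by
    intro t ht
    apply hball
    rw [Metric.mem_ball, Real.dist_eq, sub_zero, abs_lt]
    exact ⟨by linarith [ht.1], by linarith [ht.2]⟩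
  have hc : ContinuousOn (g ∘ h) (Icc (-(ε / 2)) (ε / 2)) :=
    hg.comp hh.continuous.continuousOn (hsub.mono_right hVW)
  have hinj : InjOn (g ∘ h) (Icc (-(ε / 2)) (ε / 2)) :=
    hi.comp hh.injective.injOn (hsub.mono_right hVW)
  have himg : (g ∘ h) '' Icc (-(ε / 2)) (ε / 2) ⊆ g '' V := by
    rw [image_comp]
    exact image_mono hsub.image_subset
  have hle : -(ε / 2) ≤ ε / 2 := by linarith
  have h0 : (0 : ℝ) ∈ Icc (-(ε / 2)) (ε / 2) := ⟨by linarith, by linarith⟩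
  have hl : -(ε / 2) ∈ Icc (-(ε / 2)) (ε / 2) := ⟨le_rfl, hle⟩
  have hr : ε / 2 ∈ Icc (-(ε / 2)) (ε / 2) := ⟨hle, le_rfl⟩
  rcases hc.strictMonoOn_of_injOn_Icc' hle hinj with hm | hm
  · exact mem_of_superset (Icc_mem_nhds (hm hl h0 (by linarith)) (hm h0 hr (by linarith)))
      ((intermediate_value_Icc hle hc).trans himg)
  · exact mem_of_superset (Icc_mem_nhds (hm h0 hr (by linarith)) (hm hl h0 (by linarith)))
      ((intermediate_value_Icc' hle hc).trans himg)

/-- A bounded continuous injective function on a connected open set is a homeomorphism onto a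
bounded open interval. -/
theorem LocallyReal.exists_inverse (hY : LocallyReal Y) {W : Set Y} {g : Y → ℝ}
    (hW : IsOpen W) (hWc : IsPreconnected W) (hne : W.Nonempty)
    (hg : ContinuousOn g W) (hi : InjOn g W) (ha : BddAbove (g '' W)) (hb : BddBelow (g '' W)) :
    ∃ (a b : ℝ) (k : ℝ → Y), a < b ∧ g '' W = Ioo a b ∧ ContinuousOn k (Ioo a b) ∧
      k '' Ioo a b = W ∧ ∀ s ∈ Ioo a b, g (k s) = s := by
  have hopen := hY.isOpen_image hg hi hW Subset.rfl
  have himg : g '' W = Ioo (sInf (g '' W)) (sSup (g '' W)) := by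
    refine Subset.antisymm ?_ (IsConnected.Ioo_csInf_csSup_subset ⟨hne.image g, hWc.image g hg⟩ hb ha)
    rw [← interior_Icc]
    exact interior_maximal (subset_Icc_csInf_csSup hb ha) hopen
  have : Nonempty Y := ⟨hne.some⟩
  have hinv : ∀ s ∈ g '' W, Function.invFunOn g W s ∈ W ∧ g (Function.invFunOn g W s) = s :=
    fun s hs => ⟨Function.invFunOn_mem hs, Function.invFunOn_eq hs⟩
  refine ⟨sInf (g '' W), sSup (g '' W), Function.invFunOn g W, ?_, himg, ?_⟩
  · obtain ⟨y, hy⟩ := hne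
    have : g y ∈ Ioo (sInf (g '' W)) (sSup (g '' W)) := himg ▸ mem_image_of_mem g hy
    exact this.1.trans this.2
  rw [← himg]
  refine ⟨?_, ?_, fun s hs => (hinv s hs).2⟩
  · rw [hopen.continuousOn_iff]
    intro s hs
    rw [ContinuousAt, tendsto_nhds]
    intro V hV hsV
    have hO := hY.isOpen_image hg hi (hV.inter hW) inter_subset_right
    refine mem_of_superset (hO.mem_nhds ⟨_, ⟨hsV, (hinv s hs).1⟩, (hinv s hs).2⟩) ?_
    rintro _ ⟨y, hy, rfl⟩
    have := hinv (g y) ⟨y, hy.2, rfl⟩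
    rw [mem_preimage, hi this.1 hy.2 this.2]
    exact hy.1
  · ext y
    constructor
    · rintro ⟨s, hs, rfl⟩
      exact (hinv s hs).1
    · intro hy
      have := hinv (g y) ⟨y, hy, rfl⟩
      exact ⟨g y, ⟨y, hy, rfl⟩, hi this.1 hy this.2⟩
-- Each set is measured by the total weight of the basic open sets it contains, with summable
-- weights `(1/2)^n`. A point of `W'` outside `W` has a basic neighbourhood inside `W'`, which is
-- counted for `W'` but not for `W`.
theorem exists_bounded_strictMono_on_opens (Y : Type*) [TopologicalSpace Y]
    [SecondCountableTopology Y] :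
    ∃ (m : Set Y → ℝ) (C : ℝ), Monotone m ∧ (∀ W, m W ≤ C) ∧
      ∀ W W' : Set Y, IsOpen W' → W ⊂ W' → m W < m W' := by
  classical
  obtain ⟨B, hBc, -, hB⟩ := TopologicalSpace.exists_countable_basis Y
  -- The empty set is added only to make the family nonempty, so that it can be enumerated by `ℕ`.
  obtain ⟨b, hb⟩ : ∃ b : ℕ → Set Y, insert ∅ B = range b :=
    (hBc.insert ∅).exists_eq_range (insert_nonempty _ _)
  let w : Set Y → ℕ → ℝ := fun W n => if b n ⊆ W then (1 / 2 : ℝ) ^ n else 0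
  have hw0 : ∀ W n, 0 ≤ w W n := fun W n => by
    dsimp only [w]; split_ifs <;> positivity
  have hw1 : ∀ W n, w W n ≤ (1 / 2 : ℝ) ^ n := fun W n => by
    dsimp only [w]; split_ifs
    · exact le_rfl
    · positivity
  have hs : ∀ W, Summable (w W) := fun W =>
    Summable.of_nonneg_of_le (hw0 W) (hw1 W) summable_geometric_two
  have hmono : ∀ W W', W ⊆ W' → ∀ n, w W n ≤ w W' n := fun W W' h n => by
    by_cases hn : b n ⊆ W
    · simp [w, hn, hn.trans h]
    · simp only [w, hn, if_false]
      exact hw0 W' n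
  refine ⟨fun W => ∑' n, w W n, ∑' n, (1 / 2 : ℝ) ^ n,
    fun W W' h => (hs W).tsum_le_tsum (hmono W W' h) (hs W'),
    fun W => (hs W).tsum_le_tsum (hw1 W) summable_geometric_two, ?_⟩
  intro W W' hW' hss
  obtain ⟨y, hy, hyW⟩ := exists_of_ssubset hss
  obtain ⟨V, hV, hyV, hVW⟩ := hB.exists_subset_of_mem_open hy hW'
  obtain ⟨n, rfl⟩ : V ∈ range b := hb ▸ mem_insert_of_mem _ hV
  refine Summable.tsum_lt_tsum (i := n) (hmono W W' hss.subset) ?_ (hs W) (hs W')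
  have hn : ¬ b n ⊆ W := fun h => hyW (h hyV)
  simp [w, hn, hVW]

/-! ### Maximal coordinate functions -/

/-- A coordinate function on a connected open set, of oscillation controlled by `m`. -/
structure PartialCoord (m : Set Y → ℝ) where
  dom : Set Y
  fn : Y → ℝ
  isOpen : IsOpen dom
  isPreconnected : IsPreconnected dom
  nonempty : dom.Nonempty
  continuousOn : ContinuousOn fn dom
  injOn : InjOn fn dom
  bound : ∀ x ∈ dom, ∀ y ∈ dom, fn x - fn y ≤ 2 + m dom

/-- `Q` extends `P`. -/
def PartialCoord.Extends {m : Set Y → ℝ} (P Q : PartialCoord m) : Prop :=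
  P.dom ⊆ Q.dom ∧ EqOn P.fn Q.fn P.dom

/-- Zorn's lemma. Any two points in the union of a chain lie in a common domain, so injectivity
passes to the union, and so does the oscillation bound because `m` is monotone. -/
theorem LocallyReal.exists_maximal_partialCoord [Nonempty Y] (hY : LocallyReal Y)
    {m : Set Y → ℝ} (hm : Monotone m) (hm0 : ∀ W, 0 ≤ m W) :
    ∃ P : PartialCoord m, ∀ Q, P.Extends Q → Q.Extends P := by
  classical
  have : Nonempty (PartialCoord m) := by
    obtain ⟨h, hh, -⟩ := hY (Classical.arbitrary Y)
    have hinv : ∀ t, Function.invFun h (h t) = t := Function.leftInverse_invFun hh.injective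
    have hopen : IsOpen (h '' Ioo (-1) 1) := hh.isOpenMap _ isOpen_Ioo
    refine ⟨⟨h '' Ioo (-1) 1, Function.invFun h, hopen,
      isPreconnected_Ioo.image _ hh.continuous.continuousOn, ⟨h 0, 0, by norm_num, rfl⟩,
      ?_, ?_, ?_⟩⟩
    · rintro _ ⟨t, -, rfl⟩
      apply ContinuousAt.continuousWithinAt
      rw [← hh.continuousAt_iff]
      exact (continuousAt_id (x := t)).congr (Eventually.of_forall fun s => (hinv s).symm)
    · rintro _ ⟨t, -, rfl⟩ _ ⟨s, -, rfl⟩ hts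
      rw [hinv, hinv] at hts
      rw [hts]
    -- The initial coordinate has range of length `2`, which accounts for the constant in `bound`.
    · rintro _ ⟨t, ht, rfl⟩ _ ⟨s, hs, rfl⟩
      rw [hinv, hinv]
      linarith [ht.2, hs.1, hm0 (h '' Ioo (-1) 1)]
  refine exists_maximal_of_nonempty_chains_bounded (r := PartialCoord.Extends) ?_
    fun h₁ h₂ => ⟨h₁.1.trans h₂.1, fun y hy => (h₁.2 hy).trans (h₂.2 (h₁.1 hy))⟩
  intro c hc hne
  have hpair : ∀ P ∈ c, ∀ Q ∈ c, ∃ R ∈ c, P.Extends R ∧ Q.Extends R := by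
    intro P hP Q hQ
    rcases eq_or_ne P Q with rfl | hPQ
    · exact ⟨P, hP, ⟨Subset.rfl, fun _ _ => rfl⟩, Subset.rfl, fun _ _ => rfl⟩
    rcases hc hP hQ hPQ with h | h
    · exact ⟨Q, hQ, h, Subset.rfl, fun _ _ => rfl⟩
    · exact ⟨P, hP, ⟨Subset.rfl, fun _ _ => rfl⟩, h⟩
  let f : Y → ℝ := fun y => if h : ∃ P ∈ c, y ∈ P.dom then h.choose.fn y else 0
  have hf : ∀ P ∈ c, ∀ y ∈ P.dom, f y = P.fn y := by
    intro P hP y hy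
    have h : ∃ P ∈ c, y ∈ P.dom := ⟨P, hP, hy⟩
    have h1 : f y = h.choose.fn y := dif_pos h
    obtain ⟨R, -, hPR, hQR⟩ := hpair P hP _ h.choose_spec.1
    rw [h1, hPR.2 hy, hQR.2 h.choose_spec.2]
  have hmem : ∀ {y}, y ∈ ⋃ P ∈ c, P.dom ↔ ∃ P ∈ c, y ∈ P.dom := by
    intro y; simp only [mem_iUnion, exists_prop]
  have hsub : ∀ P ∈ c, P.dom ⊆ ⋃ P ∈ c, P.dom := fun P hP y hy => hmem.2 ⟨P, hP, hy⟩
  have hboth : ∀ x ∈ ⋃ P ∈ c, P.dom, ∀ y ∈ ⋃ P ∈ c, P.dom,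
      ∃ R ∈ c, x ∈ R.dom ∧ y ∈ R.dom := by
    intro x hx y hy
    obtain ⟨P, hP, hxP⟩ := hmem.1 hx
    obtain ⟨Q, hQ, hyQ⟩ := hmem.1 hy
    obtain ⟨R, hR, hPR, hQR⟩ := hpair P hP Q hQ
    exact ⟨R, hR, hPR.1 hxP, hQR.1 hyQ⟩
  refine ⟨⟨⋃ P ∈ c, P.dom, f, isOpen_biUnion fun P _ => P.isOpen, ?_, ?_, ?_, ?_, ?_⟩,
    fun P hP => ⟨hsub P hP, fun y hy => (hf P hP y hy).symm⟩⟩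
  · refine isPreconnected_of_forall_pair fun x hx y hy => ?_
    obtain ⟨R, hR, hxR, hyR⟩ := hboth x hx y hy
    exact ⟨R.dom, hsub R hR, hxR, hyR, R.isPreconnected⟩
  · obtain ⟨P, hP⟩ := hne
    exact P.nonempty.mono (hsub P hP)
  · intro y hy
    obtain ⟨P, hP, hyP⟩ := hmem.1 hy
    apply ContinuousAt.continuousWithinAt
    have hn := P.isOpen.mem_nhds hyP
    refine (P.continuousOn.continuousAt hn).congr ?_
    filter_upwards [hn] with z hz using (hf P hP z hz).symm
  · intro x hx y hy hxy
    obtain ⟨R, hR, hxR, hyR⟩ := hboth x hx y hy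
    rw [hf R hR x hxR, hf R hR y hyR] at hxy
    exact R.injOn hxR hyR hxy
  · intro x hx y hy
    obtain ⟨R, hR, hxR, hyR⟩ := hboth x hx y hy
    rw [hf R hR x hxR, hf R hR y hyR]
    have := hm (hsub R hR)
    have := R.bound x hxR y hyR
    linarith

/-- Extending a coordinate function beyond the end of its domain by an affine function. -/
theorem exists_extension {W : Set Y} (hW : IsOpen W) {g : Y → ℝ} (hg : ContinuousOn g W)
    (hi : InjOn g W) {h : ℝ → Y} (hh : IsOpenEmbedding h) {ε : ℝ} (hε : 0 < ε)
    (hleft : ∀ t ∈ Ioc (-ε) 0, h t ∉ W) (hright : ∀ t ∈ Ioo 0 ε, h t ∈ W) {c d : ℝ} (hd : d ≠ 0)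
    (hlim : Tendsto (g ∘ h) (𝓝[>] 0) (𝓝 c)) (hnot : ∀ t ∈ Ioc (-ε) 0, c + d * t ∉ g '' W) :
    ∃ g' : Y → ℝ, EqOn g g' W ∧ (∀ t ∈ Ioc (-ε) 0, g' (h t) = c + d * t) ∧
      ContinuousOn g' (W ∪ h '' Ioo (-ε) ε) ∧ InjOn g' (W ∪ h '' Ioo (-ε) ε) := by
  classical
  let g' : Y → ℝ := fun y => if y ∈ W then g y else c + d * Function.invFun h y
  have h1 : EqOn g g' W := fun y hy => (if_pos hy).symm
  have h2 : ∀ t ∈ Ioc (-ε) 0, g' (h t) = c + d * t := fun t ht => by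
    simp only [g', hleft t ht, if_false, Function.leftInverse_invFun hh.injective t]
  have hcase : ∀ y ∈ W ∪ h '' Ioo (-ε) ε, y ∈ W ∨ ∃ t ∈ Ioc (-ε) 0, h t = y := by
    rintro y (hy | ⟨t, ht, rfl⟩)
    · exact Or.inl hy
    · rcases le_or_gt t 0 with h0 | h0
      · exact Or.inr ⟨t, ⟨ht.1, h0⟩, rfl⟩
      · exact Or.inl (hright t ⟨h0, ht.2⟩)
  refine ⟨g', h1, h2, ?_, ?_⟩
  · intro y hy
    apply ContinuousAt.continuousWithinAt
    rcases hcase y hy with hyW | ⟨t, ht, rfl⟩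
    · have hn := hW.mem_nhds hyW
      exact (hg.continuousAt hn).congr (by filter_upwards [hn] with z hz using h1 hz)
    · rw [← hh.continuousAt_iff]
      have haff : Continuous fun t : ℝ => c + d * t := by fun_prop
      rcases ht.2.lt_or_eq with h0 | rfl
      · refine haff.continuousAt.congr ?_
        filter_upwards [Ioo_mem_nhds ht.1 h0] with s hs using (h2 s ⟨hs.1, hs.2.le⟩).symm
      -- At the junction `h 0` the affine piece and the old coordinate have the same limit `c`.
      · rw [continuousAt_iff_continuous_left'_right']
        have h0 : (g' ∘ h) 0 = c := by simpa using h2 0 ht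
        constructor
        · rw [ContinuousWithinAt, h0]
          have : Tendsto (fun t : ℝ => c + d * t) (𝓝[<] 0) (𝓝 c) := by
            simpa using (haff.tendsto 0).mono_left nhdsWithin_le_nhds
          refine this.congr' ?_
          filter_upwards [Ioo_mem_nhdsLT ht.1] with s hs using (h2 s ⟨hs.1, hs.2.le⟩).symm
        · rw [ContinuousWithinAt, h0]
          refine hlim.congr' ?_
          filter_upwards [Ioo_mem_nhdsGT hε] with s hs using h1 (hright s hs)
  · intro x hx y hy hxy
    rcases hcase x hx with hx | ⟨t, ht, rfl⟩ <;> rcases hcase y hy with hy | ⟨s, hs, rfl⟩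
    · rw [← h1 hx, ← h1 hy] at hxy
      exact hi hx hy hxy
    · rw [← h1 hx, h2 s hs] at hxy
      exact absurd ⟨x, hx, hxy⟩ (hnot s hs)
    · rw [← h1 hy, h2 t ht] at hxy
      exact absurd ⟨y, hy, hxy.symm⟩ (hnot t ht)
    · rw [h2 t ht, h2 s hs] at hxy
      rw [mul_left_cancel₀ hd (add_left_cancel hxy)]

/-- If a connected open set accumulates at the point `h 0` from the right, it contains a one-sided
neighbourhood of this point. -/
theorem exists_Ioo_mapsTo_of_frequently [T2Space Y] {W : Set Y} (hWc : IsPreconnected W)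
    (hW : IsOpen W) {h : ℝ → Y} (hh : IsOpenEmbedding h) (hcl : h 0 ∈ closure W)
    (hacc : ∀ ε > 0, ∃ t ∈ Ioo 0 ε, h t ∈ W) (h0 : h 0 ∉ W) :
    ∃ ε > 0, ∀ t ∈ Ioo 0 ε, h t ∈ W := by
  by_cases H : ∀ t > 0, h t ∈ W
  · exact ⟨1, one_pos, fun t ht => H t ht.1⟩
  push Not at H
  obtain ⟨s, hs, hsW⟩ := H
  obtain ⟨t, ht, htW⟩ := hacc s hs
  have hclosed : IsClosed (h ⁻¹' Wᶜ) := hW.isClosed_compl.preimage hh.continuous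
  -- Here `(a, b)` is the largest interval around `t` that `h` maps into `W`. Its endpoints are sent
  -- outside `W` and the compact image of `[a, b]` is closed, so the connected set `W` lies in the
  -- image of `(a, b)`. Then `h 0 ∈ closure W` forces `a = 0`.
  obtain ⟨a, haK, ha⟩ := (isCompact_Icc.inter_right hclosed).exists_isGreatest
    (s := Icc 0 t ∩ h ⁻¹' Wᶜ) ⟨0, ⟨le_rfl, ht.1.le⟩, h0⟩
  obtain ⟨b, hbK, hb⟩ := (isCompact_Icc.inter_right hclosed).exists_isLeast
    (s := Icc t s ∩ h ⁻¹' Wᶜ) ⟨s, ⟨ht.2.le, le_rfl⟩, hsW⟩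
  have hat : a < t := lt_of_le_of_ne haK.1.2 (by rintro rfl; exact haK.2 htW)
  have htb : t < b := lt_of_le_of_ne hbK.1.1 (by rintro rfl; exact hbK.2 htW)
  have hab : ∀ r ∈ Ioo a b, h r ∈ W := by
    intro r hr
    by_contra hrW
    rcases le_total r t with hrt | hrt
    · exact absurd (ha ⟨⟨haK.1.1.trans hr.1.le, hrt⟩, hrW⟩) hr.1.not_ge
    · exact absurd (hb ⟨⟨hrt, hr.2.le.trans hbK.1.2⟩, hrW⟩) hr.2.not_ge
  have hKclosed : IsClosed (h '' Icc a b) := (isCompact_Icc.image hh.continuous).isClosed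
  have hsub : W ⊆ h '' Ioo a b := by
    refine hWc.subset_left_of_subset_union (hh.isOpenMap _ isOpen_Ioo) hKclosed.isOpen_compl ?_ ?_
      ⟨h t, htW, t, ⟨hat, htb⟩, rfl⟩
    · exact disjoint_compl_right.mono_left (image_mono Ioo_subset_Icc_self)
    · intro w hw
      by_cases hwK : w ∈ h '' Icc a b
      · obtain ⟨r, hr, rfl⟩ := hwK
        refine Or.inl ⟨r, ⟨lt_of_le_of_ne hr.1 ?_, lt_of_le_of_ne hr.2 ?_⟩, rfl⟩
        · rintro rfl; exact haK.2 hw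
        · rintro rfl; exact hbK.2 hw
      · exact Or.inr hwK
  obtain ⟨r, hr, hr0⟩ :=
    closure_minimal (hsub.trans (image_mono Ioo_subset_Icc_self)) hKclosed hcl
  obtain rfl := hh.injective hr0
  obtain rfl : a = 0 := le_antisymm hr.1 haK.1.1
  exact ⟨b, ht.1.trans htb, hab⟩
-- Closing up to a circle
/-- A loop which is injective except for its endpoints and covers the space makes it a circle. -/
theorem nonempty_homeomorph_circle_of_loop [T2Space Y] {κ : ℝ → Y} {a b : ℝ} (hab : a < b)
    (hκ : ContinuousOn κ (Icc a b)) (hends : κ a = κ b) (hinj : InjOn κ (Ico a b))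
    (hsurj : κ '' Ico a b = univ) : Nonempty (Y ≃ₜ Circle) := by
  have hpos : 0 < b - a := sub_pos.2 hab
  have : Fact (0 < b - a) := ⟨hpos⟩
  have hb : a + (b - a) = b := by ring
  let F : AddCircle (b - a) → Y := AddCircle.liftIco (b - a) a κ
  have hF : Continuous F := AddCircle.liftIco_continuous (by rw [hb, hends]) (by rwa [hb])
  have hFx : ∀ x ∈ Ico a b, F x = κ x := fun x hx =>
    AddCircle.liftIco_coe_apply (by rwa [hb])
  have hrep : ∀ z : AddCircle (b - a), ∃ x ∈ Ico a b, (x : AddCircle (b - a)) = z := by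
    intro z
    have : z ∈ ((↑) : ℝ → AddCircle (b - a)) '' Ico a (a + (b - a)) := by
      rw [AddCircle.coe_image_Ico_eq]; trivial
    rwa [hb] at this
  have hbij : Function.Bijective F := by
    constructor
    · intro z w hzw
      obtain ⟨x, hx, rfl⟩ := hrep z
      obtain ⟨y, hy, rfl⟩ := hrep w
      rw [hFx x hx, hFx y hy] at hzw
      rw [hinj hx hy hzw]
    · intro y
      obtain ⟨x, hx, rfl⟩ : y ∈ κ '' Ico a b := hsurj ▸ mem_univ y
      exact ⟨x, hFx x hx⟩
  have hcont : Continuous (Equiv.ofBijective F hbij) := hF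
  exact ⟨hcont.homeoOfEquivCompactToT2.symm.trans (AddCircle.homeomorphCircle hpos.ne')⟩

/-- A connected subset of a chart cannot meet both sides of a point which it avoids. -/
theorem not_mapsTo_of_both_sides {h : ℝ → Y} (hh : IsOpenEmbedding h) {ε : ℝ} {A : Set Y}
    (hA : IsPreconnected A) (hsub : A ⊆ h '' Ioo (-ε) ε) (h0 : h 0 ∉ A)
    (hr : (A ∩ h '' Ioo 0 ε).Nonempty) (hl : (A ∩ h '' Ioo (-ε) 0).Nonempty) : False := by
  obtain ⟨y, -, ⟨t, ht, rfl⟩, s, hs, hst⟩ := hA _ _ (hh.isOpenMap _ isOpen_Ioo)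
    (hh.isOpenMap _ isOpen_Ioo) (by
      intro y hy
      obtain ⟨t, ht, rfl⟩ := hsub hy
      rcases lt_trichotomy t 0 with h' | rfl | h'
      · exact Or.inr ⟨t, ⟨ht.1, h'⟩, rfl⟩
      · exact absurd hy h0
      · exact Or.inl ⟨t, ⟨h', ht.2⟩, rfl⟩) hr hl
  have := hh.injective hst
  linarith [ht.1, hs.2]

/-- An arc both of whose ends converge to the same point closes up to a circle. -/
theorem nonempty_homeomorph_circle_of_ends [T2Space Y] [ConnectedSpace Y] {k : ℝ → Y} {a b : ℝ}
    (hab : a < b) (hk : ContinuousOn k (Ioo a b)) (hinj : InjOn k (Ioo a b))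
    (hW : IsOpen (k '' Ioo a b)) {h : ℝ → Y} (hh : IsOpenEmbedding h) {ε : ℝ} (hε : 0 < ε)
    (h0 : h 0 ∉ k '' Ioo a b) (hr : ∀ t ∈ Ioo 0 ε, h t ∈ k '' Ioo a b)
    (hl : ∀ t ∈ Ioo (-ε) 0, h t ∈ k '' Ioo a b) (hka : Tendsto k (𝓝[>] a) (𝓝 (h 0)))
    (hkb : Tendsto k (𝓝[<] b) (𝓝 (h 0))) : Nonempty (Y ≃ₜ Circle) := by
  classical
  let κ : ℝ → Y := fun s => if s ∈ Ioo a b then k s else h 0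
  have hκ1 : EqOn k κ (Ioo a b) := fun s hs => (if_pos hs).symm
  have hκa : κ a = h 0 := if_neg fun hs => lt_irrefl _ hs.1
  have hκb : κ b = h 0 := if_neg fun hs => lt_irrefl _ hs.2
  have hIco : Ico a b = insert a (Ioo a b) := (Ioo_insert_left hab).symm
  have himg : κ '' Ico a b = insert (h 0) (k '' Ioo a b) := by
    rw [hIco, image_insert_eq, hκa, hκ1.image_eq]
  have hcont : ContinuousOn κ (Icc a b) := by
    intro s hs
    rcases hs.1.eq_or_lt with rfl | has
    · have h1 : ContinuousWithinAt κ (Ioi a) a := by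
        rw [ContinuousWithinAt, hκa]
        refine hka.congr' ?_
        filter_upwards [Ioo_mem_nhdsGT hab] with s hs using hκ1 hs
      exact (continuousWithinAt_Ioi_iff_Ici.1 h1).mono Icc_subset_Ici_self
    rcases hs.2.eq_or_lt with rfl | hsb
    · have h1 : ContinuousWithinAt κ (Iio s) s := by
        rw [ContinuousWithinAt, hκb]
        refine hkb.congr' ?_
        filter_upwards [Ioo_mem_nhdsLT hab] with s hs using hκ1 hs
      exact (continuousWithinAt_Iio_iff_Iic.1 h1).mono Icc_subset_Iic_self
    · have hn := Ioo_mem_nhds has hsb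
      refine ((hk.continuousAt hn).congr ?_).continuousWithinAt
      filter_upwards [hn] with s hs using hκ1 hs
  refine nonempty_homeomorph_circle_of_loop hab hcont (hκa.trans hκb.symm) ?_ ?_
  · rw [hIco, injOn_insert (fun h => lt_irrefl _ h.1), hκa, ← hκ1.image_eq]
    exact ⟨hinj.congr hκ1, h0⟩
  · have hIcc : κ '' Icc a b = κ '' Ico a b := by
      refine Subset.antisymm ?_ (image_mono Ico_subset_Icc_self)
      rintro _ ⟨s, hs, rfl⟩
      rcases hs.2.eq_or_lt with rfl | hsb
      · exact ⟨a, ⟨le_rfl, hab⟩, hκa.trans hκb.symm⟩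
      · exact ⟨s, ⟨hs.1, hsb⟩, rfl⟩
    -- The loop is compact, hence closed, and it is open because both sides of `h 0` lie in the arc.
    -- Connectedness makes it the whole space.
    have hclosed : IsClosed (κ '' Ico a b) :=
      hIcc ▸ (isCompact_Icc.image_of_continuousOn hcont).isClosed
    have hopen : IsOpen (κ '' Ico a b) := by
      have : κ '' Ico a b = k '' Ioo a b ∪ h '' Ioo (-ε) ε := by
        rw [himg]
        apply Subset.antisymm
        · exact insert_subset (Or.inr ⟨0, ⟨by linarith, hε⟩, rfl⟩) subset_union_left
        · apply union_subset (subset_insert _ _)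
          rintro _ ⟨t, ht, rfl⟩
          rcases lt_trichotomy t 0 with h' | rfl | h'
          · exact Or.inr (hl t ⟨ht.1, h'⟩)
          · exact Or.inl rfl
          · exact Or.inr (hr t ⟨h', ht.2⟩)
      rw [this]
      exact hW.union (hh.isOpenMap _ isOpen_Ioo)
    exact IsClopen.eq_univ ⟨hclosed, hopen⟩ (himg ▸ insert_nonempty _ _)

theorem forall_sub_le_of_Ioo {a b B : ℝ} (hab : a < b)
    (h : ∀ s ∈ Ioo a b, ∀ t ∈ Ioo a b, s - t ≤ B) : b - a ≤ B := by
  by_contra! hlt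
  set η := min (b - a - B) (b - a) with hη
  have h1 : 0 < η := lt_min (by linarith) (by linarith)
  have h2 : η ≤ b - a - B := min_le_left _ _
  have h3 : η ≤ b - a := min_le_right _ _
  have := h (b - η / 3) ⟨by linarith, by linarith⟩ (a + η / 3) ⟨by linarith, by linarith⟩
  linarith

/-- A maximal coordinate function that is not defined everywhere closes up to a circle at any
point where its domain accumulates. -/
theorem nonempty_homeomorph_circle_of_maximal [T2Space Y] [ConnectedSpace Y] (hY : LocallyReal Y)
    {m : Set Y → ℝ} {C : ℝ} (hmC : ∀ W, m W ≤ C)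
    (hm : ∀ W W' : Set Y, IsOpen W' → W ⊂ W' → m W < m W') {P : PartialCoord m}
    (hP : ∀ Q, P.Extends Q → Q.Extends P) {h : ℝ → Y} (hh : IsOpenEmbedding h)
    (hcl : h 0 ∈ closure P.dom) (h0 : h 0 ∉ P.dom)
    (hacc : ∀ ε > 0, ∃ t ∈ Ioo 0 ε, h t ∈ P.dom) : Nonempty (Y ≃ₜ Circle) := by
  obtain ⟨ε, hε, hr⟩ :=
    exists_Ioo_mapsTo_of_frequently P.isPreconnected P.isOpen hh hcl hacc h0
  obtain ⟨y₀, hy₀⟩ := P.nonempty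
  obtain ⟨a, b, k, hab, himg, hk, hkW, hgk⟩ := hY.exists_inverse P.isOpen P.isPreconnected
    P.nonempty P.continuousOn P.injOn
    ⟨P.fn y₀ + (2 + C), by
      rintro _ ⟨y, hy, rfl⟩
      linarith [P.bound y hy y₀ hy₀, hmC P.dom]⟩
    ⟨P.fn y₀ - (2 + C), by
      rintro _ ⟨y, hy, rfl⟩
      linarith [P.bound y₀ hy₀ y hy, hmC P.dom]⟩
  have hkinj : InjOn k (Ioo a b) := fun s hs t ht hst => by
    rw [← hgk s hs, ← hgk t ht, hst]
  have hkg : ∀ y ∈ P.dom, k (P.fn y) = y := by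
    intro y hy
    rw [← hkW] at hy
    obtain ⟨s, hs, rfl⟩ := hy
    rw [hgk s hs]
  have hsep : ∀ w ∈ k '' Ioo a b, ¬ NbhdInseparable w (h 0) := by
    intro w hw hins
    have hne : w ≠ h 0 := by rintro rfl; exact h0 (hkW ▸ hw)
    obtain ⟨U, V, hU, hV, hwU, hV0, hUV⟩ := t2_separation hne
    exact (hins U (hU.mem_nhds hwU) V (hV.mem_nhds hV0)).ne_empty hUV.inter_eq
  have hgc : ContinuousOn P.fn (k '' Ioo a b) := hkW ▸ P.continuousOn
  have hendr := tendsto_end hk hgk hgc hε hh.continuous.continuousOn hh.injective.injOn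
    (fun t ht => hkW ▸ hr t ht) hsep
  have hbound : b - a ≤ 2 + m P.dom := by
    refine forall_sub_le_of_Ioo hab fun s hs t ht => ?_
    have h1 := P.bound (k s) (hkW ▸ mem_image_of_mem k hs) (k t) (hkW ▸ mem_image_of_mem k ht)
    rwa [hgk s hs, hgk t ht] at h1
  -- If the domain also accumulates from the left, the two sides of `h 0` run into different ends of
  -- the arc and close it up. Otherwise the coordinate extends across `h 0`, contradicting
  -- maximality.
  by_cases haccl : ∀ ε > 0, ∃ t ∈ Ioo 0 ε, h (-t) ∈ P.dom
  · have hh' : IsOpenEmbedding (h ∘ Neg.neg) := hh.comp (Homeomorph.neg ℝ).isOpenEmbedding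
    have h0' : (h ∘ Neg.neg) 0 = h 0 := by simp
    obtain ⟨δ, hδ, hl⟩ := exists_Ioo_mapsTo_of_frequently P.isPreconnected P.isOpen hh'
      (by rwa [h0']) haccl (by rwa [h0'])
    have hendl := tendsto_end hk hgk hgc hδ hh'.continuous.continuousOn hh'.injective.injOn
      (fun t ht => hkW ▸ hl t ht) (by rwa [h0'])
    rw [h0'] at hendl
    have hη : 0 < min ε δ := lt_min hε hδ
    have hr' : ∀ t ∈ Ioo 0 (min ε δ), h t ∈ P.dom :=
      fun t ht => hr t ⟨ht.1, ht.2.trans_le (min_le_left _ _)⟩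
    have hl' : ∀ t ∈ Ioo (-min ε δ) 0, h t ∈ P.dom := fun t ht => by
      have := hl (-t) ⟨by linarith [ht.2], by linarith [ht.1, min_le_right ε δ]⟩
      simpa using this
    have hnbhd : h '' Ioo (-min ε δ) (min ε δ) ∈ 𝓝 (h 0) :=
      (hh.isOpenMap _ isOpen_Ioo).mem_nhds ⟨0, ⟨by linarith, hη⟩, rfl⟩
    -- The two sides of the point `h 0` cannot lie at the same end of the arc.
    have key : ∀ (F : Filter ℝ) (I : Set ℝ), I ∈ F → IsPreconnected I → I ⊆ Ioo a b →
        MapsTo k I (h '' Ioo (-min ε δ) (min ε δ)) → Tendsto (P.fn ∘ h) (𝓝[>] 0) F →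
        Tendsto (P.fn ∘ h ∘ Neg.neg) (𝓝[>] 0) F → False := by
      intro F I hIF hIc hIab hmaps hF hF'
      have hmem : ∀ y ∈ P.dom, P.fn y ∈ I → y ∈ k '' I :=
        fun y hy hyI => ⟨P.fn y, hyI, hkg y hy⟩
      -- A tail of the arc at the common end would be a connected set in the chart that avoids `h 0`
      -- but meets both sides of it.
      refine not_mapsTo_of_both_sides hh (hIc.image k (hk.mono hIab)) hmaps.image_subset ?_ ?_ ?_
      · rintro ⟨s, hs, hs0⟩
        exact h0 (hs0 ▸ hkW ▸ mem_image_of_mem k (hIab hs))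
      · obtain ⟨t, ht, htI⟩ := ((hF.eventually_mem hIF).and (Ioo_mem_nhdsGT hη)).exists
        exact ⟨h t, hmem _ (hr' t htI) ht, t, htI, rfl⟩
      · obtain ⟨t, ht, htI⟩ := ((hF'.eventually_mem hIF).and (Ioo_mem_nhdsGT hη)).exists
        have htI' : -t ∈ Ioo (-min ε δ) 0 := ⟨by linarith [htI.2], by linarith [htI.1]⟩
        exact ⟨h (-t), hmem _ (hl' _ htI') ht, -t, htI', rfl⟩
    have hfnr : ∀ᶠ t in 𝓝[>] (0 : ℝ), P.fn (h t) ∈ Ioo a b := by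
      filter_upwards [Ioo_mem_nhdsGT hη] with t ht
      exact himg ▸ mem_image_of_mem _ (hr' t ht)
    have hfnl : ∀ᶠ t in 𝓝[>] (0 : ℝ), P.fn (h (-t)) ∈ Ioo a b := by
      filter_upwards [Ioo_mem_nhdsGT hη] with t ht
      exact himg ▸ mem_image_of_mem _ (hl' (-t) ⟨by linarith [ht.2], by linarith [ht.1]⟩)
    have fin : Tendsto k (𝓝[>] a) (𝓝 (h 0)) → Tendsto k (𝓝[<] b) (𝓝 (h 0)) →
        Nonempty (Y ≃ₜ Circle) := fun h₁ h₂ =>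
      nonempty_homeomorph_circle_of_ends hab hk hkinj (by rw [hkW]; exact P.isOpen) hh hη
        (by rwa [hkW]) (by rwa [hkW]) (by rwa [hkW]) h₁ h₂
    rcases hendr with ⟨hgr, hkr⟩ | ⟨hgr, hkr⟩ <;> rcases hendl with ⟨hgl, hkl⟩ | ⟨hgl, hkl⟩
    · exfalso
      obtain ⟨c, hc, hcs⟩ := mem_nhdsGT_iff_exists_Ioo_subset.1
        (inter_mem (hkr.eventually_mem hnbhd) (Ioo_mem_nhdsGT hab))
      refine key (𝓝[>] a) (Ioo a c) (Ioo_mem_nhdsGT hc) isPreconnected_Ioo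
        (fun s hs => (hcs hs).2) (fun s hs => (hcs hs).1) ?_ ?_
      · exact tendsto_nhdsWithin_iff.2 ⟨hgr, hfnr.mono fun t ht => ht.1⟩
      · exact tendsto_nhdsWithin_iff.2 ⟨hgl, hfnl.mono fun t ht => ht.1⟩
    · exact fin hkr hkl
    · exact fin hkl hkr
    · exfalso
      obtain ⟨c, hc, hcs⟩ := mem_nhdsLT_iff_exists_Ioo_subset.1
        (inter_mem (hkr.eventually_mem hnbhd) (Ioo_mem_nhdsLT hab))
      refine key (𝓝[<] b) (Ioo c b) (Ioo_mem_nhdsLT hc) isPreconnected_Ioo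
        (fun s hs => (hcs hs).2) (fun s hs => (hcs hs).1) ?_ ?_
      · exact tendsto_nhdsWithin_iff.2 ⟨hgr, hfnr.mono fun t ht => ht.2⟩
      · exact tendsto_nhdsWithin_iff.2 ⟨hgl, hfnl.mono fun t ht => ht.2⟩
  · exfalso
    push Not at haccl
    obtain ⟨δ, hδ, hl⟩ := haccl
    set η := min ε δ with hηdef
    have hη : 0 < η := lt_min hε hδ
    have hηε : η ≤ ε := min_le_left _ _
    have hηδ : η ≤ δ := min_le_right _ _
    have hright : ∀ t ∈ Ioo 0 η, h t ∈ P.dom := fun t ht => hr t ⟨ht.1, ht.2.trans_le hηε⟩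
    have hleft : ∀ t ∈ Ioc (-η) 0, h t ∉ P.dom := by
      intro t ht
      rcases ht.2.eq_or_lt with rfl | ht0
      · exact h0
      · have := hl (-t) ⟨by linarith, by linarith [ht.1]⟩
        rwa [neg_neg] at this
    set W' := P.dom ∪ h '' Ioo (-η) η with hW'
    have h0W' : h 0 ∈ W' := Or.inr ⟨0, ⟨by linarith, hη⟩, rfl⟩
    have hss : P.dom ⊂ W' :=
      ⟨subset_union_left, fun hsub => h0 (hsub h0W')⟩
    have hopen : IsOpen W' := P.isOpen.union (hh.isOpenMap _ isOpen_Ioo)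
    have hconn : IsPreconnected W' :=
      P.isPreconnected.union' ⟨h (η / 2), hright _ ⟨by linarith, by linarith⟩, η / 2,
        ⟨by linarith, by linarith⟩, rfl⟩ (isPreconnected_Ioo.image _ hh.continuous.continuousOn)
    have hgain : 0 < m W' - m P.dom := sub_pos.2 (hm _ _ hopen hss)
    -- With this slope the affine piece of parameter length `η` uses up exactly the extra
    -- oscillation that `bound` grants to `W'`.
    set d := (m W' - m P.dom) / η with hd
    have hdpos : 0 < d := div_pos hgain hη
    have hdη : d * η = m W' - m P.dom := div_mul_cancel₀ _ hη.ne'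
    -- It remains to extend by a function with small enough oscillation.
    have fin : ∀ c e A : ℝ, Tendsto (P.fn ∘ h) (𝓝[>] 0) (𝓝 c) → e ≠ 0 →
        (∀ t ∈ Ioc (-η) 0, c + e * t ∉ Ioo a b) → Ioo a b ⊆ Icc A (A + (2 + m W')) →
        (∀ t ∈ Ioc (-η) 0, c + e * t ∈ Icc A (A + (2 + m W'))) → False := by
      intro c e A hc he hnot hA hA'
      obtain ⟨g', hg1, hg2, hg3, hg4⟩ := exists_extension P.isOpen P.continuousOn P.injOn hh hη
        hleft hright he hc (by rwa [himg])
      have hA'' : ∀ y ∈ W', g' y ∈ Icc A (A + (2 + m W')) := by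
        rintro y (hy | ⟨t, ht, rfl⟩)
        · rw [← hg1 hy]
          exact hA (himg ▸ mem_image_of_mem _ hy)
        · rcases le_or_gt t 0 with ht0 | ht0
          · rw [hg2 t ⟨ht.1, ht0⟩]
            exact hA' t ⟨ht.1, ht0⟩
          · have hy := hright t ⟨ht0, ht.2⟩
            rw [← hg1 hy]
            exact hA (himg ▸ mem_image_of_mem _ hy)
      let Q : PartialCoord m := ⟨W', g', hopen, hconn, ⟨_, h0W'⟩, hg3, hg4,
        fun x hx y hy => by linarith [(hA'' x hx).2, (hA'' y hy).1]⟩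
      exact hss.2 (hP Q ⟨hss.1, hg1⟩).1
    have hdt : ∀ t ∈ Ioc (-η) 0, -(m W' - m P.dom) ≤ d * t ∧ d * t ≤ 0 := by
      intro t ht
      constructor
      · rw [← hdη]
        nlinarith [ht.1]
      · exact mul_nonpos_of_nonneg_of_nonpos hdpos.le ht.2
    -- The new values must leave `(a, b)` as `t` decreases from `0`: downwards from `a` with slope
    -- `d`, upwards from `b` with slope `-d`.
    rcases hendr with ⟨hg, -⟩ | ⟨hg, -⟩
    · refine fin a d (a - (m W' - m P.dom)) hg hdpos.ne' ?_ ?_ ?_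
      · intro t ht hmem
        linarith [hmem.1, (hdt t ht).2]
      · intro s hs
        constructor <;> linarith [hs.1, hs.2]
      · intro t ht
        have := hdt t ht
        constructor <;> linarith
    · refine fin b (-d) a hg (neg_ne_zero.2 hdpos.ne') ?_ ?_ ?_
      · intro t ht hmem
        linarith [hmem.2, (hdt t ht).2]
      · intro s hs
        constructor <;> linarith [hs.1, hs.2]
      · intro t ht
        have := hdt t ht
        constructor <;> linarith

/-- **Classification of one-dimensional manifolds**: a connected second countable Hausdorff space
that is locally homeomorphic to the line is homeomorphic to the circle or to an open interval. -/
theorem LocallyReal.circle_or_interval [T2Space Y] [ConnectedSpace Y] [SecondCountableTopology Y]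
    (hY : LocallyReal Y) : Nonempty (Y ≃ₜ Circle) ∨
      ∃ (e : ℝ → Y) (g : Y → ℝ), ContinuousOn e (Ioo 0 1) ∧ e '' Ioo 0 1 = univ ∧
        Continuous g ∧ ∀ s ∈ Ioo (0 : ℝ) 1, g (e s) = s := by
  obtain ⟨m₀, C₀, hmono, hmC, hm⟩ := exists_bounded_strictMono_on_opens Y
  -- Normalized to be nonnegative, so that the initial coordinate satisfies its bound.
  let m : Set Y → ℝ := fun W => m₀ W - m₀ ∅
  have hm0 : ∀ W, 0 ≤ m W := fun W => sub_nonneg.2 (hmono (empty_subset W))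
  have hm1 : ∀ W W' : Set Y, IsOpen W' → W ⊂ W' → m W < m W' :=
    fun W W' h h' => sub_lt_sub_right (hm W W' h h') _
  have hm2 : ∀ W, m W ≤ C₀ - m₀ ∅ := fun W => sub_le_sub_right (hmC W) _
  obtain ⟨P, hP⟩ := hY.exists_maximal_partialCoord (m := m)
    (fun W W' h => sub_le_sub_right (hmono h) _) hm0
  by_cases huniv : P.dom = univ
  · right
    have hbd : ∀ x y, P.fn x - P.fn y ≤ 2 + (C₀ - m₀ ∅) := fun x y =>
      (P.bound x (huniv ▸ mem_univ x) y (huniv ▸ mem_univ y)).trans (by linarith [hm2 P.dom])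
    obtain ⟨y₀, -⟩ := P.nonempty
    obtain ⟨a, b, k, hab, himg, hk, hkW, hgk⟩ := hY.exists_inverse P.isOpen P.isPreconnected
      P.nonempty P.continuousOn P.injOn
      ⟨P.fn y₀ + (2 + (C₀ - m₀ ∅)), by
        rintro _ ⟨y, hy, rfl⟩
        linarith [hbd y y₀]⟩
      ⟨P.fn y₀ - (2 + (C₀ - m₀ ∅)), by
        rintro _ ⟨y, hy, rfl⟩
        linarith [hbd y₀ y]⟩
    have hpos : 0 < b - a := sub_pos.2 hab
    have hmaps : MapsTo (fun s => a + (b - a) * s) (Ioo 0 1) (Ioo a b) := by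
      intro s hs
      constructor <;> nlinarith [hs.1, hs.2]
    have hgc : Continuous P.fn := by
      rw [← continuousOn_univ, ← huniv]
      exact P.continuousOn
    refine ⟨fun s => k (a + (b - a) * s), fun y => (P.fn y - a) / (b - a),
      hk.comp (by fun_prop) hmaps, ?_, by fun_prop, ?_⟩
    · rw [eq_univ_iff_forall]
      intro y
      have hy : y ∈ k '' Ioo a b := by rw [hkW, huniv]; trivial
      obtain ⟨s, hs, rfl⟩ := hy
      refine ⟨(s - a) / (b - a), ⟨div_pos (by linarith [hs.1]) hpos,
        (div_lt_one hpos).2 (by linarith [hs.2])⟩, ?_⟩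
      simp only [mul_div_cancel₀ _ hpos.ne']
      congr 1
      ring
    · intro s hs
      simp only [hgk _ (hmaps hs)]
      field_simp
      ring
  · left
    have hnc : ¬ IsClosed P.dom := fun hc => huniv (IsClopen.eq_univ ⟨hc, P.isOpen⟩ P.nonempty)
    obtain ⟨p, hpc, hp⟩ : ∃ p ∈ closure P.dom, p ∉ P.dom := by
      by_contra! hcon
      exact hnc (isClosed_of_closure_subset hcon)
    obtain ⟨h, hh, rfl⟩ := hY p
    -- A domain that does not accumulate at `h 0` from the right does so from the left, and the
    -- reflected chart applies.
    by_cases hacc : ∀ ε > 0, ∃ t ∈ Ioo 0 ε, h t ∈ P.dom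
    · exact nonempty_homeomorph_circle_of_maximal hY hm2 hm1 hP hh hpc hp hacc
    · have h0' : (h ∘ Neg.neg) 0 = h 0 := by simp
      refine nonempty_homeomorph_circle_of_maximal hY hm2 hm1 hP (h := h ∘ Neg.neg)
        (hh.comp (Homeomorph.neg ℝ).isOpenEmbedding) (by rwa [h0']) (by rwa [h0']) ?_
      push Not at hacc
      obtain ⟨δ, hδ, hr⟩ := hacc
      intro ε hε
      have hη : 0 < min ε δ := lt_min hε hδ
      obtain ⟨_, ⟨t, ht, rfl⟩, htP⟩ := mem_closure_iff.1 hpc (h '' Ioo (-min ε δ) (min ε δ))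
        (hh.isOpenMap _ isOpen_Ioo) ⟨0, ⟨by linarith, hη⟩, rfl⟩
      rcases lt_trichotomy t 0 with ht0 | rfl | ht0
      · refine ⟨-t, ⟨by linarith, by linarith [ht.1, min_le_left ε δ]⟩, ?_⟩
        simpa using htP
      · exact absurd htP hp
      · exact absurd htP (hr t ⟨ht0, ht.2.trans_le (min_le_right _ _)⟩)

end LocallyReal

/-! ### Charts of one-dimensional manifolds -/

section Charts

variable {M : Type u} [TopologicalSpace M]

theorem IsOneManifold.t1Space (hM : IsOneManifold M) : T1Space M := by
  rw [t1Space_iff_exists_open]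
  intro x y hxy
  obtain ⟨U, hU, hxU, φ, hφ⟩ := hM x
  by_cases hy : y ∈ U
  · have := hφ.isEmbedding.t1Space
    refine ⟨(↑) '' ({⟨y, hy⟩}ᶜ : Set U), hU.isOpenMap_subtype_val _ isOpen_compl_singleton,
      ⟨⟨x, hxU⟩, fun h => hxy (congrArg Subtype.val h), rfl⟩, ?_⟩
    rintro ⟨z, hz, hzy⟩
    exact hz (Subtype.ext hzy)
  · exact ⟨U, hU, hxU, hy⟩

/-- Around every point there is the inverse of a chart, as a function on the real line. -/
theorem IsOneManifold.exists_inverse_chart (hM : IsOneManifold M) (x : M) :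
    ∃ (c : ℝ) (O : Set ℝ) (ψ : ℝ → M), c ∈ O ∧ O ⊆ Ico 0 1 ∧ O ∈ 𝓝[Ico 0 1] c ∧ ψ c = x ∧
      ContinuousOn ψ O ∧ InjOn ψ O ∧ (∀ r ∈ O, ∀ A ∈ 𝓝[O] r, ψ '' A ∈ 𝓝 (ψ r)) ∧
      (c = 0 → x ∈ boundary M) := by
  obtain ⟨U, hU, hx, φ, hφ⟩ := hM x
  have he : IsEmbedding ((↑) ∘ φ : U → ℝ) := IsEmbedding.subtypeVal.comp hφ.isEmbedding
  set e : U → ℝ := (↑) ∘ φ with he_def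
  have : Nonempty U := ⟨⟨x, hx⟩⟩
  have hinv : ∀ u, Function.invFun e (e u) = u := Function.leftInverse_invFun he.injective
  have hmap : ∀ u, 𝓝[range e] (e u) = map e (𝓝 u) := fun u => (he.map_nhds_eq u).symm
  refine ⟨e ⟨x, hx⟩, range e, fun r => ((Function.invFun e r : U) : M), mem_range_self _, ?_, ?_, ?_,
    ?_, ?_, ?_, ?_⟩
  · rintro _ ⟨u, rfl⟩
    exact (φ u).2
  · have h1 : range φ ∈ 𝓝 (φ ⟨x, hx⟩) := hφ.isOpen_range.mem_nhds (mem_range_self _)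
    have h2 := image_mem_map (m := ((↑) : Ico (0 : ℝ) 1 → ℝ)) h1
    rwa [map_nhds_subtype_val, ← range_comp] at h2
  · simp only [hinv]
  · rintro _ ⟨u, rfl⟩
    rw [ContinuousWithinAt, hmap, tendsto_map'_iff]
    simp only [Function.comp_def, hinv]
    exact continuous_subtype_val.tendsto u
  · rintro _ ⟨u, rfl⟩ _ ⟨v, rfl⟩ huv
    simp only [hinv] at huv
    rw [Subtype.ext huv]
  · rintro _ ⟨u, rfl⟩ A hA
    rw [hmap] at hA
    simp only [hinv]
    refine mem_of_superset (hU.isOpenEmbedding_subtypeVal.image_mem_nhds.2 hA) ?_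
    rintro _ ⟨v, hv, rfl⟩
    exact ⟨e v, hv, by simp only [hinv]⟩
  · intro h0
    exact ⟨U, hU, hx, φ, hφ, h0⟩

/-- A non-boundary point has positive chart value, so a small ball around this value lies in the
chart image; it is then stretched to the whole line. -/
theorem IsOneManifold.exists_isOpenEmbedding (hM : IsOneManifold M) {x : M} (hx : x ∉ boundary M)
    {V : Set M} (hV : IsOpen V) (hxV : x ∈ V) :
    ∃ h : ℝ → M, IsOpenEmbedding h ∧ h 0 = x ∧ range h ⊆ V := by
  obtain ⟨c, O, ψ, hcO, hOI, hO, rfl, hcont, hinj, hnhds, hbd⟩ := hM.exists_inverse_chart x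
  have hc : 0 < c := lt_of_le_of_ne (hOI hcO).1 fun h => hx (hbd h.symm)
  have hOc : O ∈ 𝓝 c := by
    rwa [nhdsWithin_eq_nhds.2 (Ico_mem_nhds hc (hOI hcO).2)] at hO
  have hV' : ψ ⁻¹' V ∈ 𝓝 c := (hcont.continuousAt hOc).preimage_mem_nhds (hV.mem_nhds hxV)
  obtain ⟨δ, hδ, hball⟩ := Metric.mem_nhds_iff.1 (inter_mem hOc hV')
  let b := OpenPartialHomeomorph.univBall c δ
  have hb : IsOpenEmbedding b := b.isOpenEmbedding (OpenPartialHomeomorph.univBall_source c δ)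
  have hmem : ∀ t, b t ∈ Metric.ball c δ := fun t => by
    rw [← OpenPartialHomeomorph.univBall_target c hδ]
    exact b.map_source (by rw [OpenPartialHomeomorph.univBall_source]; trivial)
  refine ⟨ψ ∘ b, ?_, ?_, ?_⟩
  · refine IsOpenEmbedding.of_continuous_injective_isOpenMap ?_ ?_ ?_
    · exact hcont.comp_continuous hb.continuous fun t => (hball (hmem t)).1
    · intro s t hst
      exact hb.injective (hinj (hball (hmem s)).1 (hball (hmem t)).1 hst)
    · intro A hA
      rw [isOpen_iff_mem_nhds]
      rintro _ ⟨t, ht, rfl⟩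
      rw [image_comp]
      exact hnhds _ (hball (hmem t)).1 _
        (mem_nhdsWithin_of_mem_nhds ((hb.isOpenMap A hA).mem_nhds ⟨t, ht, rfl⟩))
  · exact congrArg ψ (OpenPartialHomeomorph.univBall_apply_zero c δ)
  · rintro _ ⟨t, rfl⟩
    exact (hball (hmem t)).2

/-- Every point has neighbourhoods made up of two arcs (possibly equal) issuing from it. -/
theorem IsOneManifold.exists_two_arcs (hM : IsOneManifold M) (y : M) :
    ∃ (γ : Bool → ℝ → M) (ε : ℝ), 0 < ε ∧ (∀ i, γ i 0 = y ∧ ContinuousOn (γ i) (Ico 0 ε) ∧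
      InjOn (γ i) (Ico 0 ε)) ∧ ∀ δ > 0, (⋃ i, γ i '' Ico 0 δ) ∈ 𝓝 y := by
  obtain ⟨c, O, ψ, hcO, hOI, hO, rfl, hcont, hinj, hnhds, -⟩ := hM.exists_inverse_chart y
  -- At chart value `0` there is only one arc, which is listed twice.
  rcases (hOI hcO).1.eq_or_lt with rfl | hc
  · have hO' : O ∈ 𝓝[≥] (0 : ℝ) := by
      rwa [nhdsWithin_Ico_eq_nhdsGE one_pos] at hO
    obtain ⟨ε, hε, hεO⟩ := mem_nhdsGE_iff_exists_Ico_subset.1 hO'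
    refine ⟨fun _ => ψ, ε, hε, fun _ => ⟨rfl, hcont.mono hεO, hinj.mono hεO⟩, fun δ hδ => ?_⟩
    rw [iUnion_const]
    refine hnhds 0 hcO _ (nhdsWithin_mono 0 ?_ (Ico_mem_nhdsGE hδ))
    exact fun r hr => (hOI hr).1
  · have hOc : O ∈ 𝓝 c := by
      rwa [nhdsWithin_eq_nhds.2 (Ico_mem_nhds hc (hOI hcO).2)] at hO
    obtain ⟨ε, hε, hball⟩ := Metric.mem_nhds_iff.1 hOc
    have hσ : ∀ σ : ℝ, |σ| = 1 → MapsTo (fun t => c + σ * t) (Ico 0 ε) O := by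
      intro σ hσ t ht
      apply hball
      rw [Metric.mem_ball, Real.dist_eq, add_sub_cancel_left, abs_mul, hσ, one_mul,
        abs_of_nonneg ht.1]
      exact ht.2
    have hσ' : ∀ σ : ℝ, |σ| = 1 → ψ (c + σ * 0) = ψ c ∧
        ContinuousOn (fun t => ψ (c + σ * t)) (Ico 0 ε) ∧
        InjOn (fun t => ψ (c + σ * t)) (Ico 0 ε) := by
      intro σ h1
      have h0 : σ ≠ 0 := by rintro rfl; simp at h1
      refine ⟨by simp, hcont.comp (by fun_prop) (hσ σ h1), fun s hs t ht hst => ?_⟩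
      exact mul_left_cancel₀ h0 (add_left_cancel (hinj (hσ σ h1 hs) (hσ σ h1 ht) hst))
    refine ⟨fun i t => ψ (c + (bif i then 1 else -1) * t), ε, hε,
      fun i => hσ' _ (by cases i <;> simp), fun δ hδ => ?_⟩
    refine mem_of_superset (hnhds c hcO (Ioo (c - δ) (c + δ)) (mem_nhdsWithin_of_mem_nhds
      (Ioo_mem_nhds (by linarith) (by linarith)))) ?_
    rintro _ ⟨r, hr, rfl⟩
    rw [mem_iUnion]
    rcases le_total c r with h | h
    · exact ⟨true, r - c, ⟨by linarith, by linarith [hr.2]⟩, by simp⟩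
    · exact ⟨false, c - r, ⟨by linarith, by linarith [hr.1]⟩, by simp⟩

end Charts

/-! ### Edges of graph-like manifolds -/

section Edges

variable {M : Type u} [TopologicalSpace M]

theorem eq_of_nbhdInseparable {x y : M} (hx : x ∉ singularSet M) (h : NbhdInseparable x y) :
    y = x := by
  by_contra hne
  exact hx (Or.inl ⟨y, hne, h⟩)

theorem eq_of_chainInseparable {x y : M} (hx : x ∉ singularSet M) (h : ChainInseparable x y) :
    y = x := by
  induction h with
  | refl => rfl
  | tail _ h ih =>
    rw [ih] at h
    exact eq_of_nbhdInseparable hx h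

theorem chainProj_eq_iff {x y : M} : chainProj M x = chainProj M y ↔ ChainInseparable x y :=
  ⟨fun h => Quotient.exact h, fun h => Quotient.sound h⟩

theorem eq_of_chainProj_eq {x y : M} (hx : x ∉ singularSet M)
    (h : chainProj M x = chainProj M y) : y = x :=
  eq_of_chainInseparable hx (chainProj_eq_iff.1 h)

theorem chainProj_eq_of_nbhdInseparable {x y : M} (h : NbhdInseparable x y) :
    chainProj M x = chainProj M y :=
  chainProj_eq_iff.2 (Relation.ReflTransGen.single h)

/-- Points are closed, so the finitely many other singular points nearby can be removed. -/
theorem IsGraphLike.exists_mem_nhds_inter_subset (hM : IsGraphLike M) (y : M) :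
    ∃ U ∈ 𝓝 y, U ∩ singularSet M ⊆ {y} := by
  have := hM.isOneManifold.t1Space
  obtain ⟨U, hU, hfin⟩ := hM.locallyFinite y
  have hcl : IsClosed ((U ∩ singularSet M) \ {y}) := (hfin.subset sdiff_subset).isClosed
  refine ⟨U ∩ ((U ∩ singularSet M) \ {y})ᶜ,
    inter_mem hU (hcl.isOpen_compl.mem_nhds fun h => h.2 rfl), ?_⟩
  rintro z ⟨⟨hzU, hz⟩, hzS⟩
  by_contra hzy
  exact hz ⟨⟨hzU, hzS⟩, hzy⟩

theorem IsGraphLike.isOpen_compl (hM : IsGraphLike M) : IsOpen (singularSet M)ᶜ := by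
  rw [isOpen_iff_mem_nhds]
  intro y hy
  obtain ⟨U, hU, hUS⟩ := hM.exists_mem_nhds_inter_subset y
  refine mem_of_superset hU fun z hz hzS => hy ?_
  rwa [← show z = y from hUS ⟨hz, hzS⟩]

theorem IsGraphLike.exists_isOpenEmbedding (hM : IsGraphLike M) {x y : M}
    (hy : y ∈ connectedComponentIn (singularSet M)ᶜ x) :
    ∃ h : ℝ → M, IsOpenEmbedding h ∧ h 0 = y ∧
      range h ⊆ connectedComponentIn (singularSet M)ᶜ x := by
  have hyS : y ∉ singularSet M := connectedComponentIn_subset _ _ hy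
  obtain ⟨h, hh, h0, hr⟩ := hM.isOneManifold.exists_isOpenEmbedding
    (fun hb => hyS (Or.inr hb)) hM.isOpen_compl hyS
  refine ⟨h, hh, h0, ?_⟩
  rw [connectedComponentIn_eq hy]
  exact (isPreconnected_range hh.continuous).subset_connectedComponentIn ⟨0, h0⟩ hr

theorem IsGraphLike.isOpen_connectedComponentIn (hM : IsGraphLike M) (x : M) :
    IsOpen (connectedComponentIn (singularSet M)ᶜ x) := by
  rw [isOpen_iff_mem_nhds]
  intro y hy
  obtain ⟨h, hh, rfl, hr⟩ := hM.exists_isOpenEmbedding hy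
  exact mem_of_superset (hh.isOpen_range.mem_nhds (mem_range_self 0)) hr

/-- An ultrafilter on `K` converging to a point `y` of the closure also converges to some `c ∈ K`.
Then `c` and `y` are inseparable, and `c` is nonsingular, so `y = c`. This replaces the Hausdorff
property when circle components are excluded. -/
theorem isClosed_of_isCompact_of_subset_compl {K : Set M} (hK : IsCompact K)
    (hKS : K ⊆ (singularSet M)ᶜ) : IsClosed K := by
  refine isClosed_of_closure_subset fun y hy => ?_
  obtain ⟨F, hFK, hFy⟩ := mem_closure_iff_ultrafilter.1 hy
  obtain ⟨c, hc, hFc⟩ := isCompact_iff_ultrafilter_le_nhds.1 hK F (le_principal_iff.2 hFK)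
  rwa [eq_of_nbhdInseparable (hKS hc)
    (nbhdInseparable_of_tendsto (f := id) (l := (F : Filter M)) hFc hFy)]

/-- A parametrization of the set `J` by the open unit interval. -/
structure ArcParam (J : Set M) where
  toFun : ℝ → M
  inv : M → ℝ
  continuousOn : ContinuousOn toFun (Ioo 0 1)
  image_eq : toFun '' Ioo 0 1 = J
  continuousOn_inv : ContinuousOn inv J
  inv_apply : ∀ s ∈ Ioo (0 : ℝ) 1, inv (toFun s) = s

theorem IsGraphLike.nonempty_arcParam [ConnectedSpace M] (hM : IsGraphLike M)
    (hS : ¬ Nonempty (M ≃ₜ Circle)) {x : M} (hx : x ∈ (singularSet M)ᶜ) :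
    Nonempty (ArcParam (connectedComponentIn (singularSet M)ᶜ x)) := by
  classical
  set J := connectedComponentIn (singularSet M)ᶜ x with hJ
  have hJS : J ⊆ (singularSet M)ᶜ := connectedComponentIn_subset _ _
  have hxJ : x ∈ J := mem_connectedComponentIn hx
  have hJo : IsOpen J := hM.isOpen_connectedComponentIn x
  have : SecondCountableTopology J := hM.countableBase x hx
  have : ConnectedSpace J :=
    isConnected_iff_connectedSpace.1 ⟨⟨x, hxJ⟩, isPreconnected_connectedComponentIn⟩
  have : T2Space J := by
    refine ⟨fun a b hab => ?_⟩
    have hins : ¬ NbhdInseparable (a : M) b := fun h =>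
      hab (Subtype.ext (eq_of_nbhdInseparable (hJS a.2) h).symm)
    unfold NbhdInseparable at hins
    push Not at hins
    obtain ⟨U, hU, V, hV, hUV⟩ := hins
    obtain ⟨U', hU', hUo, haU⟩ := mem_nhds_iff.1 hU
    obtain ⟨V', hV', hVo, hbV⟩ := mem_nhds_iff.1 hV
    refine ⟨Subtype.val ⁻¹' U', Subtype.val ⁻¹' V', hUo.preimage continuous_subtype_val,
      hVo.preimage continuous_subtype_val, haU, hbV, ?_⟩
    exact Disjoint.preimage _ ((disjoint_iff_inter_eq_empty.2 hUV).mono hU' hV')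
  have hlr : LocallyReal J := by
    rintro ⟨y, hy⟩
    obtain ⟨h, hh, h0, hr⟩ := hM.exists_isOpenEmbedding hy
    refine ⟨fun t => ⟨h t, hr (mem_range_self t)⟩, ?_, Subtype.ext h0⟩
    exact IsOpenEmbedding.of_comp _ hJo.isOpenEmbedding_subtypeVal hh
  rcases hlr.circle_or_interval with ⟨⟨φ⟩⟩ | ⟨e, g, he, hes, hg, hge⟩
  · exfalso
    have : CompactSpace J := φ.symm.compactSpace
    have huniv : J = univ := IsClopen.eq_univ
      ⟨isClosed_of_isCompact_of_subset_compl (isCompact_iff_compactSpace.2 this) hJS, hJo⟩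
      ⟨x, hxJ⟩
    exact hS ⟨(Homeomorph.Set.univ M).symm.trans ((Homeomorph.setCongr huniv.symm).trans φ)⟩
  · refine ⟨⟨fun s => e s, fun y => if h : y ∈ J then g ⟨y, h⟩ else 0, ?_, ?_, ?_, ?_⟩⟩
    · exact continuous_subtype_val.comp_continuousOn he
    · rw [← image_image (fun z : J => (z : M)) e, hes, image_univ, Subtype.range_coe]
    · rw [continuousOn_iff_continuous_domRestrict]
      convert hg using 1
      ext ⟨y, hy⟩
      simp [hy]
    · intro s hs
      simp only [Subtype.coe_prop, dif_pos]
      exact hge s hs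

variable (M) in
/-- The edges of a graph-like manifold: the components of the complement of the singular set. -/
def Edges : Type u :=
  {J : Set M // ∃ x ∈ (singularSet M)ᶜ, connectedComponentIn (singularSet M)ᶜ x = J}

instance : TopologicalSpace (Edges M) := ⊥

instance : DiscreteTopology (Edges M) := ⟨rfl⟩

theorem Edges.subset_compl (J : Edges M) : J.1 ⊆ (singularSet M)ᶜ := by
  obtain ⟨_, x, hx, rfl⟩ := J
  exact connectedComponentIn_subset _ _

theorem Edges.eq_connectedComponentIn (J : Edges M) {y : M} (hy : y ∈ J.1) :
    J.1 = connectedComponentIn (singularSet M)ᶜ y := by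
  obtain ⟨_, x, hx, rfl⟩ := J
  exact connectedComponentIn_eq hy

theorem Edges.eq_of_mem {J K : Edges M} {y : M} (hJ : y ∈ J.1) (hK : y ∈ K.1) : J = K :=
  Subtype.ext ((J.eq_connectedComponentIn hJ).trans (K.eq_connectedComponentIn hK).symm)

theorem IsGraphLike.isOpen_edge (hM : IsGraphLike M) (J : Edges M) : IsOpen J.1 := by
  obtain ⟨_, x, hx, rfl⟩ := J
  exact hM.isOpen_connectedComponentIn x

theorem exists_edge {x : M} (hx : x ∉ singularSet M) : ∃ J : Edges M, x ∈ J.1 :=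
  ⟨⟨_, x, hx, rfl⟩, mem_connectedComponentIn hx⟩

theorem ArcParam.mem {J : Edges M} (e : ArcParam J.1) {s : ℝ} (hs : s ∈ Ioo (0 : ℝ) 1) :
    e.toFun s ∈ J.1 := e.image_eq.subset (mem_image_of_mem _ hs)

theorem ArcParam.notMem_singularSet {J : Edges M} (e : ArcParam J.1) {s : ℝ}
    (hs : s ∈ Ioo (0 : ℝ) 1) : e.toFun s ∉ singularSet M := J.subset_compl (e.mem hs)

theorem ArcParam.exists_eq {J : Edges M} (e : ArcParam J.1) {y : M} (hy : y ∈ J.1) :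
    ∃ s ∈ Ioo (0 : ℝ) 1, e.toFun s = y := e.image_eq.symm.subset hy

/-- The arc converges to `y` at the parameter `t`. -/
def ArcParam.LimAt {J : Set M} (e : ArcParam J) (t : ℝ) (y : M) : Prop :=
  Tendsto e.toFun (𝓝[Ioo 0 1] t) (𝓝 y)

theorem neBot_nhdsWithin_Ioo {t : ℝ} (ht : t ∈ Icc (0 : ℝ) 1) : (𝓝[Ioo 0 1] t).NeBot := by
  rwa [← mem_closure_iff_nhdsWithin_neBot, closure_Ioo zero_ne_one]

theorem ArcParam.limAt_of_mem_Ioo {J : Set M} (e : ArcParam J) {t : ℝ}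
    (ht : t ∈ Ioo (0 : ℝ) 1) : e.LimAt t (e.toFun t) := e.continuousOn t ht

theorem ArcParam.LimAt.chainProj_eq {J : Set M} {e : ArcParam J} {t : ℝ} {y z : M}
    (hy : e.LimAt t y) (hz : e.LimAt t z) (ht : t ∈ Icc (0 : ℝ) 1) :
    chainProj M y = chainProj M z :=
  have := neBot_nhdsWithin_Ioo ht
  chainProj_eq_of_nbhdInseparable (nbhdInseparable_of_tendsto hy hz)

/-- If `y` is nonsingular, the edge through `y` is open and is met by the arc, so it is `J`.
Continuity of the inverse at `y` then gives `t = inv y`. Thus the ends of an edge converge only to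
singular points. -/
theorem ArcParam.LimAt.mem_Ioo (hM : IsGraphLike M) {J : Edges M} {e : ArcParam J.1} {t : ℝ}
    {y : M} (hy : e.LimAt t y) (ht : t ∈ Icc (0 : ℝ) 1) (hyS : y ∉ singularSet M) :
    t ∈ Ioo (0 : ℝ) 1 := by
  have := neBot_nhdsWithin_Ioo ht
  obtain ⟨K, hK⟩ := exists_edge hyS
  have hev : ∀ᶠ s in 𝓝[Ioo 0 1] t, e.toFun s ∈ K.1 ∧ s ∈ Ioo (0 : ℝ) 1 :=
    (hy.eventually_mem ((hM.isOpen_edge K).mem_nhds hK)).and self_mem_nhdsWithin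
  obtain ⟨s, hsK, hs⟩ := hev.exists
  obtain rfl := Edges.eq_of_mem hsK (e.mem hs)
  obtain ⟨r, hr, rfl⟩ := e.exists_eq hK
  have h1 := (e.continuousOn_inv.continuousAt ((hM.isOpen_edge K).mem_nhds hK)).tendsto.comp hy
  rw [e.inv_apply r hr] at h1
  have h2 : Tendsto (e.inv ∘ e.toFun) (𝓝[Ioo 0 1] t) (𝓝 t) := by
    refine (tendsto_id.mono_right nhdsWithin_le_nhds).congr' ?_
    filter_upwards [self_mem_nhdsWithin] with s hs using (e.inv_apply s hs).symm
  rwa [tendsto_nhds_unique h2 h1]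

/-- A singular point has neighbourhoods made up of two arcs (possibly equal) each of which runs
into the end of an edge. -/
theorem IsGraphLike.exists_two_ends (hM : IsGraphLike M) (e : ∀ J : Edges M, ArcParam J.1) {y : M}
    (hy : y ∈ singularSet M) :
    ∃ (γ : Bool → ℝ → M), (∀ i, γ i 0 = y) ∧ (∀ δ > 0, (⋃ i, γ i '' Ico 0 δ) ∈ 𝓝 y) ∧
      ∀ i, ∃ (J : Edges M) (t : ℝ), (t = 0 ∨ t = 1) ∧ (e J).LimAt t y ∧
        Tendsto ((e J).inv ∘ γ i) (𝓝[>] 0) (𝓝 t) ∧ ∀ᶠ s in 𝓝[>] 0, γ i s ∈ J.1 := by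
  obtain ⟨γ, ε, hε, hγ, hnhds⟩ := hM.isOneManifold.exists_two_arcs y
  refine ⟨γ, fun i => (hγ i).1, hnhds, fun i => ?_⟩
  obtain ⟨hγ0, hγc, hγi⟩ := hγ i
  obtain ⟨U, hU, hUS⟩ := hM.exists_mem_nhds_inter_subset y
  have h1 : ∀ᶠ s in 𝓝[≥] (0 : ℝ), γ i s ∈ U := by
    have := hγc 0 ⟨le_rfl, hε⟩
    rw [ContinuousWithinAt, nhdsWithin_Ico_eq_nhdsGE hε, hγ0] at this
    exact this hU
  obtain ⟨δ, hδ, hδU⟩ := mem_nhdsGE_iff_exists_Ico_subset.1 h1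
  have hη : 0 < min ε δ := lt_min hε hδ
  have hsub : Ico 0 (min ε δ) ⊆ Ico 0 ε := Ico_subset_Ico_right (min_le_left _ _)
  have hmem : ∀ s ∈ Ioo 0 (min ε δ), γ i s ∈ (singularSet M)ᶜ := by
    intro s hs hsS
    have hsy : γ i s = y := hUS ⟨hδU ⟨hs.1.le, hs.2.trans_le (min_le_right _ _)⟩, hsS⟩
    rw [← hγ0] at hsy
    exact hs.1.ne' (hγi (hsub ⟨hs.1.le, hs.2⟩) ⟨le_rfl, hε⟩ hsy)
  have hmid : min ε δ / 2 ∈ Ioo 0 (min ε δ) := ⟨by linarith, by linarith⟩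
  have hcon : IsPreconnected (γ i '' Ioo 0 (min ε δ)) :=
    isPreconnected_Ioo.image _ (hγc.mono (Ioo_subset_Ico_self.trans hsub))
  let J : Edges M := ⟨_, _, hmem _ hmid, rfl⟩
  have hJ : MapsTo (γ i) (Ioo 0 (min ε δ)) ((e J).toFun '' Ioo 0 1) := by
    rw [(e J).image_eq, mapsTo_iff_image_subset]
    exact hcon.subset_connectedComponentIn (mem_image_of_mem _ hmid) (image_subset_iff.2 hmem)
  have hev : ∀ᶠ s in 𝓝[>] 0, γ i s ∈ J.1 := by
    filter_upwards [Ioo_mem_nhdsGT hη] with s hs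
    exact (e J).image_eq.subset (hJ hs)
  -- The arc lies in the single edge `J`, whose nonsingular points are separated from `y`.
  have hend := tendsto_end (e J).continuousOn (e J).inv_apply
    (by rw [(e J).image_eq]; exact (e J).continuousOn_inv) hη (hγc.mono hsub)
    (hγi.mono (Ioo_subset_Ico_self.trans hsub)) hJ (by
      rw [(e J).image_eq, hγ0]
      intro w hw hins
      have := eq_of_nbhdInseparable (J.subset_compl hw) hins
      exact J.subset_compl hw (this ▸ hy))
  rw [hγ0] at hend
  rcases hend with ⟨hg, hk⟩ | ⟨hg, hk⟩
  · refine ⟨J, 0, Or.inl rfl, ?_, hg, hev⟩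
    rwa [ArcParam.LimAt, nhdsWithin_Ioo_eq_nhdsGT one_pos]
  · refine ⟨J, 1, Or.inr rfl, ?_, hg, hev⟩
    rwa [ArcParam.LimAt, nhdsWithin_Ioo_eq_nhdsLT one_pos]

end Edges

/-! ### The graph of chain inseparability classes -/

section ChainGraph

variable {M : Type u} [TopologicalSpace M]

/-- The endpoints of edges at which the edge does not converge. -/
def missingEnds (e : ∀ J : Edges M, ArcParam J.1) : Set (unitInterval × Edges M) :=
  {p | ¬ ∃ y, (e p.2).LimAt p.1 y}

theorem mem_Ioo_of_ne {t : unitInterval} (h0 : t ≠ 0) (h1 : t ≠ 1) : (t : ℝ) ∈ Ioo (0 : ℝ) 1 :=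
  ⟨unitInterval.pos_iff_ne_zero.2 h0, unitInterval.lt_one_iff_ne_one.2 h1⟩

theorem missingEnds_subset (e : ∀ J : Edges M, ArcParam J.1) :
    missingEnds e ⊆ endpoints (Edges M) := by
  intro p hp
  by_contra hne
  have h : ¬ (p.1 = 0 ∨ p.1 = 1) := hne
  push Not at h
  exact hp ⟨_, (e p.2).limAt_of_mem_Ioo (mem_Ioo_of_ne h.1 h.2)⟩

/-- The map from the segments to the space of chain inseparability classes that sends a point of
a segment to the class of the limit of the corresponding edge. -/
noncomputable def segmentsToChain (e : ∀ J : Edges M, ArcParam J.1)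
    (a : Segments (missingEnds e)) : ChainQuotient M :=
  chainProj M (not_not.1 a.2).choose

variable {e : ∀ J : Edges M, ArcParam J.1}

theorem exists_limAt (a : Segments (missingEnds e)) : ∃ y, (e a.1.2).LimAt a.1.1 y :=
  not_not.1 a.2

theorem segmentsToChain_eq {a : Segments (missingEnds e)} {y : M}
    (h : (e a.1.2).LimAt a.1.1 y) : segmentsToChain e a = chainProj M y :=
  ArcParam.LimAt.chainProj_eq (not_not.1 a.2).choose_spec h a.1.1.2

theorem segmentsToChain_interior {a : Segments (missingEnds e)} (h : (a.1.1 : ℝ) ∈ Ioo (0 : ℝ) 1) :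
    segmentsToChain e a = chainProj M ((e a.1.2).toFun a.1.1) :=
  segmentsToChain_eq ((e a.1.2).limAt_of_mem_Ioo h)

theorem mem_Ioo_iff_notMem_segBoundary {a : Segments (missingEnds e)} :
    (a.1.1 : ℝ) ∈ Ioo (0 : ℝ) 1 ↔ a ∉ segBoundary (missingEnds e) := by
  constructor
  · rintro h (h' | h') <;> rw [h'] at h
    · exact lt_irrefl _ h.1
    · exact lt_irrefl _ h.2
  · intro h
    have h' : ¬ (a.1.1 = 0 ∨ a.1.1 = 1) := h
    push Not at h'
    exact mem_Ioo_of_ne h'.1 h'.2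

theorem exists_singular_of_mem_segBoundary (hM : IsGraphLike M) {a : Segments (missingEnds e)}
    (ha : a ∈ segBoundary (missingEnds e)) :
    ∃ y ∈ singularSet M, (e a.1.2).LimAt a.1.1 y := by
  obtain ⟨y, hy⟩ := exists_limAt a
  refine ⟨y, ?_, hy⟩
  by_contra hyS
  exact mem_Ioo_iff_notMem_segBoundary.1 (hy.mem_Ioo hM a.1.1.2 hyS) ha

/-- The class of a nonsingular point is a singleton, edges are disjoint and each is parametrized
injectively. Endpoints cannot interfere, as their limits are singular. -/
theorem eq_of_segmentsToChain_eq (hM : IsGraphLike M) {a b : Segments (missingEnds e)}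
    (ha : a ∉ segBoundary (missingEnds e)) (h : segmentsToChain e a = segmentsToChain e b) :
    a = b := by
  have ha' := mem_Ioo_iff_notMem_segBoundary.2 ha
  rw [segmentsToChain_interior ha'] at h
  by_cases hb : b ∈ segBoundary (missingEnds e)
  · obtain ⟨y, hy, hlim⟩ := exists_singular_of_mem_segBoundary hM hb
    rw [segmentsToChain_eq hlim] at h
    have hya := eq_of_chainProj_eq ((e a.1.2).notMem_singularSet ha') h
    exact absurd (hya ▸ hy) ((e a.1.2).notMem_singularSet ha')
  · have hb' := mem_Ioo_iff_notMem_segBoundary.2 hb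
    rw [segmentsToChain_interior hb'] at h
    have hba := eq_of_chainProj_eq ((e a.1.2).notMem_singularSet ha') h
    obtain ⟨⟨t, J⟩, hP⟩ := a
    obtain ⟨⟨s, K⟩, hP'⟩ := b
    have hm := (e K).mem hb'
    obtain rfl := Edges.eq_of_mem ((e J).mem ha') (hba ▸ hm)
    have hst := congrArg (e J).inv hba
    rw [(e J).inv_apply _ ha', (e J).inv_apply _ hb'] at hst
    obtain rfl := Subtype.ext hst
    rfl

theorem exists_segment_of_mem_singularSet (hM : IsGraphLike M) {y : M} (hy : y ∈ singularSet M) :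
    ∃ a ∈ segBoundary (missingEnds e), segmentsToChain e a = chainProj M y := by
  obtain ⟨γ, -, -, hγ⟩ := hM.exists_two_ends e hy
  obtain ⟨J, t, ht, hlim, -⟩ := hγ true
  rcases ht with rfl | rfl
  · exact ⟨⟨(0, J), not_not.2 ⟨y, hlim⟩⟩, Or.inl rfl, segmentsToChain_eq hlim⟩
  · exact ⟨⟨(1, J), not_not.2 ⟨y, hlim⟩⟩, Or.inr rfl, segmentsToChain_eq hlim⟩

theorem image_segBoundary (hM : IsGraphLike M) :
    segmentsToChain e '' segBoundary (missingEnds e) = chainProj M '' singularSet M := by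
  apply Subset.antisymm
  · rintro _ ⟨a, ha, rfl⟩
    obtain ⟨y, hy, hlim⟩ := exists_singular_of_mem_segBoundary hM ha
    exact ⟨y, hy, (segmentsToChain_eq hlim).symm⟩
  · rintro _ ⟨y, hy, rfl⟩
    exact exists_segment_of_mem_singularSet hM hy

theorem segmentsToChain_surjective (hM : IsGraphLike M) :
    Function.Surjective (segmentsToChain e) := by
  intro x
  obtain ⟨y, rfl⟩ := Quotient.exists_rep x
  by_cases hy : y ∈ singularSet M
  · obtain ⟨a, -, ha⟩ := exists_segment_of_mem_singularSet (e := e) hM hy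
    exact ⟨a, ha⟩
  · obtain ⟨J, hJ⟩ := exists_edge hy
    obtain ⟨s, hs, rfl⟩ := (e J).exists_eq hJ
    exact ⟨⟨(⟨s, hs.1.le, hs.2.le⟩, J), not_not.2 ⟨_, (e J).limAt_of_mem_Ioo hs⟩⟩,
      segmentsToChain_interior hs⟩

theorem isOpen_iff_preimage_chainProj {W : Set (ChainQuotient M)} :
    IsOpen W ↔ IsOpen (chainProj M ⁻¹' W) := Iff.rfl

theorem continuous_segmentsToChain : Continuous (segmentsToChain e) := by
  rw [continuous_iff_continuousAt]
  intro a
  rw [ContinuousAt, tendsto_nhds]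
  intro W hW haW
  obtain ⟨y, hy⟩ := exists_limAt a
  rw [segmentsToChain_eq hy] at haW
  have hlim := hy.eventually_mem ((isOpen_iff_preimage_chainProj.1 hW).mem_nhds haW)
  rw [eventually_nhdsWithin_iff] at hlim
  have hcoe : Continuous fun b : Segments (missingEnds e) => (b.1.1 : ℝ) := by fun_prop
  have hsnd : Continuous fun b : Segments (missingEnds e) => b.1.2 := by fun_prop
  have hfst : Continuous fun b : Segments (missingEnds e) => b.1.1 := by fun_prop
  have h1 : ∀ᶠ b in 𝓝 a, b.1.2 = a.1.2 :=
    hsnd.continuousAt.eventually_mem ((isOpen_discrete {a.1.2}).mem_nhds rfl)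
  have h2 := hcoe.continuousAt.eventually hlim
  -- Close to `a` no endpoint occurs except possibly `a` itself, so the limit along the open
  -- interval suffices.
  have hne : ∀ c : unitInterval, ∀ᶠ b in 𝓝 a, a.1.1 = c ∨ b.1.1 ≠ c := by
    intro c
    by_cases hc : a.1.1 = c
    · exact Eventually.of_forall fun _ => Or.inl hc
    · filter_upwards [hfst.continuousAt.eventually_ne hc] with b hb using Or.inr hb
  filter_upwards [h1, h2, hne 0, hne 1] with b hb1 hb2 hb3 hb4
  by_cases hab : b.1.1 = a.1.1
  · rw [mem_preimage, show b = a from Subtype.ext (Prod.ext hab hb1), segmentsToChain_eq hy]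
    exact haW
  have hb : (b.1.1 : ℝ) ∈ Ioo (0 : ℝ) 1 := by
    refine mem_Ioo_iff_notMem_segBoundary.2 ?_
    rintro (h | h)
    · exact hab (h.trans (hb3.resolve_right fun h' => h' h).symm)
    · exact hab (h.trans (hb4.resolve_right fun h' => h' h).symm)
  rw [mem_preimage, segmentsToChain_interior hb, hb1]
  exact hb2 hb

theorem eventually_of_isOpen_preimage {W : Set (ChainQuotient M)}
    (hW : IsOpen (segmentsToChain e ⁻¹' W)) {a : Segments (missingEnds e)}
    (ha : segmentsToChain e a ∈ W) :
    ∀ᶠ s in 𝓝 (a.1.1 : ℝ), s ∈ Ioo (0 : ℝ) 1 → chainProj M ((e a.1.2).toFun s) ∈ W := by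
  obtain ⟨O, hO, hOW⟩ := isOpen_induced_iff.1 hW
  have haO : a.1 ∈ O := by
    have : a ∈ Subtype.val ⁻¹' O := hOW.symm.subset ha
    exact this
  have h1 : {t : unitInterval | (t, a.1.2) ∈ O} ∈ 𝓝 a.1.1 :=
    (hO.preimage (by fun_prop : Continuous fun t : unitInterval => (t, a.1.2))).mem_nhds haO
  rw [nhds_subtype_eq_comap, mem_comap] at h1
  obtain ⟨N, hN, hNO⟩ := h1
  filter_upwards [hN] with s hsN hs
  let b : Segments (missingEnds e) :=
    ⟨(⟨s, hs.1.le, hs.2.le⟩, a.1.2), not_not.2 ⟨_, (e a.1.2).limAt_of_mem_Ioo hs⟩⟩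
  have hbO : b ∈ Subtype.val ⁻¹' O := hNO (show (⟨s, hs.1.le, hs.2.le⟩ : unitInterval) ∈ _ from hsN)
  rw [hOW] at hbO
  rw [← segmentsToChain_interior (a := b) hs]
  exact hbO

/-- At a singular point, each of the two arcs runs into an end of an edge where `W` already contains
all nearby parameters, so an initial piece of each arc lies over `W`; together these pieces form a
neighbourhood. At a nonsingular point the edge itself is a chart. -/
theorem isQuotientMap_segmentsToChain (hM : IsGraphLike M) :
    IsQuotientMap (segmentsToChain e) := by
  refine (isQuotientMap_iff _).2 ⟨isCoinducing_iff.2 fun W =>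
    ⟨fun hW => ?_, fun hW => hW.preimage continuous_segmentsToChain⟩,
    segmentsToChain_surjective hM⟩
  rw [isOpen_iff_preimage_chainProj, isOpen_iff_mem_nhds]
  intro y hy
  by_cases hyS : y ∈ singularSet M
  · obtain ⟨γ, hγ0, hnhds, hγ⟩ := hM.exists_two_ends e hyS
    have hγW : ∀ i, ∃ δ > 0, γ i '' Ico 0 δ ⊆ chainProj M ⁻¹' W := by
      intro i
      obtain ⟨J, t, ht, hlim, hg, hmem⟩ := hγ i
      have htI : t ∈ Icc (0 : ℝ) 1 := by rcases ht with rfl | rfl <;> simp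
      let a : Segments (missingEnds e) := ⟨(⟨t, htI⟩, J), not_not.2 ⟨y, hlim⟩⟩
      have hev := eventually_of_isOpen_preimage hW (a := a) (by rwa [segmentsToChain_eq hlim])
      obtain ⟨δ, hδ, hδW⟩ := mem_nhdsGT_iff_exists_Ioo_subset.1
        ((hg.eventually hev).and hmem)
      refine ⟨δ, hδ, ?_⟩
      rintro _ ⟨s, hs, rfl⟩
      rcases hs.1.eq_or_lt with rfl | hs0
      · rwa [hγ0]
      · obtain ⟨h1, h2⟩ := hδW ⟨hs0, hs.2⟩
        obtain ⟨r, hr, hre⟩ := (e J).exists_eq h2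
        simp only [Function.comp_apply, ← hre, (e J).inv_apply r hr] at h1
        rw [mem_preimage, ← hre]
        exact h1 hr
    choose δ hδ hδW using hγW
    have hpos : 0 < min (δ true) (δ false) := lt_min (hδ _) (hδ _)
    refine mem_of_superset (hnhds _ hpos) (iUnion_subset fun i => ?_)
    refine (image_mono (Ico_subset_Ico_right ?_)).trans (hδW i)
    cases i
    · exact min_le_right _ _
    · exact min_le_left _ _
  · obtain ⟨J, hJ⟩ := exists_edge hyS
    obtain ⟨s, hs, rfl⟩ := (e J).exists_eq hJ
    let a : Segments (missingEnds e) :=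
      ⟨(⟨s, hs.1.le, hs.2.le⟩, J), not_not.2 ⟨_, (e J).limAt_of_mem_Ioo hs⟩⟩
    have hev := eventually_of_isOpen_preimage hW (a := a)
      (by rwa [segmentsToChain_interior (a := a) hs])
    have hn := (hM.isOpen_edge J).mem_nhds hJ
    have hinv := ((e J).continuousOn_inv.continuousAt hn).tendsto
    rw [(e J).inv_apply s hs] at hinv
    filter_upwards [hinv.eventually hev, hn] with z hz hzJ
    obtain ⟨r, hr, rfl⟩ := (e J).exists_eq hzJ
    rw [(e J).inv_apply r hr] at hz
    exact hz hr

/-- The gluing of the ends of edges that converge to the same class. -/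
noncomputable def endSetoid (e : ∀ J : Edges M, ArcParam J.1) : Setoid (segBoundary (missingEnds e)) :=
  Setoid.ker fun a => segmentsToChain e a.1

theorem extendSetoid_endSetoid (hM : IsGraphLike M) {a b : Segments (missingEnds e)} :
    extendSetoid (missingEnds e) (endSetoid e) a b ↔
      segmentsToChain e a = segmentsToChain e b := by
  constructor
  · rintro (rfl | ⟨ha, hb, h⟩)
    · rfl
    · exact h
  · intro h
    by_cases ha : a ∈ segBoundary (missingEnds e)
    · by_cases hb : b ∈ segBoundary (missingEnds e)
      · exact Or.inr ⟨ha, hb, h⟩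
      · exact Or.inl (eq_of_segmentsToChain_eq hM hb h.symm).symm
    · exact Or.inl (eq_of_segmentsToChain_eq hM ha h)

/-- Both spaces are quotients of the segments by the same relation. -/
theorem isOpenCWComplexWithVertices_chainQuotient (hM : IsGraphLike M)
    (e : ∀ J : Edges M, ArcParam J.1) :
    IsOpenCWComplexWithVertices (ChainQuotient M) (chainProj M '' singularSet M) := by
  let F : OpenGraph (missingEnds e) (endSetoid e) → ChainQuotient M :=
    Quotient.lift (segmentsToChain e) fun a b h => (extendSetoid_endSetoid hM).1 h
  have hq := isQuotientMap_segmentsToChain (e := e) hM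
  have hF : Continuous F := continuous_segmentsToChain.quotient_lift _
  have hbij : Function.Bijective F := by
    constructor
    · intro x y hxy
      induction x using Quotient.inductionOn with | _ a
      induction y using Quotient.inductionOn with | _ b
      exact Quotient.sound ((extendSetoid_endSetoid hM).2 hxy)
    · intro x
      obtain ⟨a, rfl⟩ := hq.surjective x
      exact ⟨Quotient.mk _ a, rfl⟩
  let E := Equiv.ofBijective F hbij
  have hsymm : Continuous E.symm := by
    rw [hq.continuous_iff]
    have : E.symm ∘ segmentsToChain e = Quotient.mk _ := by
      ext a
      exact E.symm_apply_eq.2 rfl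
    rw [this]
    exact continuous_quot_mk
  refine ⟨Edges M, inferInstance, inferInstance, missingEnds e, missingEnds_subset e, endSetoid e,
    ⟨E, hF, hsymm⟩, ?_⟩
  rw [OpenGraph.vertices, ← image_segBoundary (e := e) hM, image_image]
  rfl

/-! ### Separation by real functions -/

theorem exists_continuous_of_segments (hM : IsGraphLike M) {f : Segments (missingEnds e) → ℝ}
    (hf : Continuous f)
    (hfe : ∀ a ∈ segBoundary (missingEnds e), ∀ b ∈ segBoundary (missingEnds e),
      segmentsToChain e a = segmentsToChain e b → f a = f b) :
    ∃ F : ChainQuotient M → ℝ, Continuous F ∧ ∀ a, F (segmentsToChain e a) = f a := by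
  have hq := isQuotientMap_segmentsToChain (e := e) hM
  have hfac : ∀ a b, segmentsToChain e a = segmentsToChain e b → f a = f b := by
    intro a b h
    rcases (extendSetoid_endSetoid hM).2 h with rfl | ⟨ha, hb, h⟩
    · rfl
    · exact hfe a ha b hb h
  have hF : ∀ a, f (Function.surjInv hq.surjective (segmentsToChain e a)) = f a :=
    fun a => hfac _ _ (Function.surjInv_eq hq.surjective _)
  refine ⟨fun x => f (Function.surjInv hq.surjective x), ?_, hF⟩
  rw [hq.continuous_iff]
  exact hf.congr fun a => (hF a).symm

/-- A function on the graph that is supported in the interior of one edge. -/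
theorem exists_bump (hM : IsGraphLike M) (J : Edges M) {p : ℝ → ℝ} (hp : Continuous p)
    (h0 : p 0 = 0) (h1 : p 1 = 0) :
    ∃ F : ChainQuotient M → ℝ, Continuous F ∧
      ∀ a : Segments (missingEnds e), (a.1.2 = J → F (segmentsToChain e a) = p a.1.1) ∧
        (a.1.2 ≠ J → F (segmentsToChain e a) = 0) := by
  classical
  let f : Segments (missingEnds e) → ℝ := fun a => (if a.1.2 = J then 1 else 0) * p a.1.1
  have hχ : Continuous fun K : Edges M => if K = J then (1 : ℝ) else 0 := continuous_of_discreteTopology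
  have hf : Continuous f :=
    (hχ.comp (by fun_prop : Continuous fun a : Segments (missingEnds e) => a.1.2)).mul
      (hp.comp (by fun_prop))
  have hz : ∀ a ∈ segBoundary (missingEnds e), f a = 0 := by
    rintro a (h | h) <;> simp [f, h, h0, h1]
  obtain ⟨F, hF, hFf⟩ := exists_continuous_of_segments hM hf
    fun a ha b hb _ => (hz a ha).trans (hz b hb).symm
  refine ⟨F, hF, fun a => ⟨fun h => ?_, fun h => ?_⟩⟩ <;> rw [hFf] <;> simp [f, h]

/-- A function on the graph that is `1` at one vertex and `0` at all others. -/
theorem exists_vertex_function (hM : IsGraphLike M) (x : ChainQuotient M) :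
    ∃ F : ChainQuotient M → ℝ, Continuous F ∧ ∀ a ∈ segBoundary (missingEnds e),
      (segmentsToChain e a = x → F (segmentsToChain e a) = 1) ∧
        (segmentsToChain e a ≠ x → F (segmentsToChain e a) = 0) := by
  classical
  let A : unitInterval → Edges M → ℝ := fun t J =>
    if ∃ h : (t, J) ∉ missingEnds e, segmentsToChain e ⟨(t, J), h⟩ = x then 1 else 0
  -- Linear interpolation between the prescribed end values, a removed end being given the value
  -- `0`.
  let f : Segments (missingEnds e) → ℝ := fun a =>
    A 0 a.1.2 * (1 - a.1.1) + A 1 a.1.2 * a.1.1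
  have hA : ∀ t, Continuous fun a : Segments (missingEnds e) => A t a.1.2 := fun t =>
    (continuous_of_discreteTopology (f := A t)).comp (by fun_prop)
  have hf : Continuous f := ((hA 0).mul (by fun_prop)).add ((hA 1).mul (by fun_prop))
  have hfA : ∀ a ∈ segBoundary (missingEnds e),
      f a = if segmentsToChain e a = x then 1 else 0 := by
    rintro ⟨⟨t, J⟩, ha⟩ (h | h) <;> obtain rfl : t = _ := h <;> simp [f, A, ha]
  obtain ⟨F, hF, hFf⟩ := exists_continuous_of_segments hM hf
    fun a ha b hb h => by rw [hfA a ha, hfA b hb, h]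
  refine ⟨F, hF, fun a ha => ⟨fun h => ?_, fun h => ?_⟩⟩ <;> rw [hFf, hfA a ha] <;> simp [h]

theorem t2Space_chainQuotient (hM : IsGraphLike M) (e : ∀ J : Edges M, ArcParam J.1) :
    T2Space (ChainQuotient M) := by
  suffices h : ∀ a b : Segments (missingEnds e), segmentsToChain e a ≠ segmentsToChain e b →
      ∃ F : ChainQuotient M → ℝ, Continuous F ∧
        F (segmentsToChain e a) ≠ F (segmentsToChain e b) by
    refine ⟨fun x y hxy => ?_⟩
    obtain ⟨a, rfl⟩ := segmentsToChain_surjective (e := e) hM x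
    obtain ⟨b, rfl⟩ := segmentsToChain_surjective (e := e) hM y
    obtain ⟨F, hF, hne⟩ := h a b hxy
    exact separated_by_continuous hF hne
  have hint : ∀ a b : Segments (missingEnds e), a ∉ segBoundary (missingEnds e) →
      segmentsToChain e a ≠ segmentsToChain e b → ∃ F : ChainQuotient M → ℝ, Continuous F ∧
        F (segmentsToChain e a) ≠ F (segmentsToChain e b) := by
    intro a b ha hab
    have ha' := mem_Ioo_iff_notMem_segBoundary.2 ha
    have hpos : 0 < (a.1.1 : ℝ) * (1 - a.1.1) := mul_pos ha'.1 (by linarith [ha'.2])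
    obtain ⟨F, hF, hFa⟩ := exists_bump (e := e) hM a.1.2 (p := fun t => t * (1 - t))
      (by fun_prop) (by simp) (by simp)
    by_cases hJ : b.1.2 = a.1.2
    · by_contra! hcon
      have h1 := hcon F hF
      rw [(hFa a).1 rfl, (hFa b).1 hJ] at h1
      -- Both `t(1-t)` and `t·t(1-t)` vanish at the ends, and their quotient recovers `t`, so
      -- together they separate the points of one edge.
      obtain ⟨G, hG, hGa⟩ := exists_bump (e := e) hM a.1.2 (p := fun t => t * (t * (1 - t)))
        (by fun_prop) (by simp) (by simp)
      have h2 := hcon G hG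
      rw [(hGa a).1 rfl, (hGa b).1 hJ] at h2
      simp only [← h1] at h2
      have h3 : a.1.1 = b.1.1 := Subtype.ext (mul_right_cancel₀ hpos.ne' h2)
      exact hab (congrArg _ (Subtype.ext (Prod.ext h3 hJ.symm)))
    · refine ⟨F, hF, ?_⟩
      rw [(hFa a).1 rfl, (hFa b).2 hJ]
      exact hpos.ne'
  intro a b hab
  by_cases ha : a ∈ segBoundary (missingEnds e)
  · by_cases hb : b ∈ segBoundary (missingEnds e)
    · obtain ⟨F, hF, hFa⟩ := exists_vertex_function (e := e) hM (segmentsToChain e a)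
      refine ⟨F, hF, ?_⟩
      rw [(hFa a ha).1 rfl, (hFa b hb).2 hab.symm]
      exact one_ne_zero
    · obtain ⟨F, hF, hne⟩ := hint b a hb hab.symm
      exact ⟨F, hF, hne.symm⟩
  · exact hint a b ha hab

/-! ### The universal property -/

theorem eq_of_chainInseparable_of_continuous {B : Type v} [TopologicalSpace B] [T2Space B]
    {f : M → B} (hf : Continuous f) {x y : M} (h : ChainInseparable x y) : f x = f y := by
  induction h with
  | refl => rfl
  | tail _ h ih =>
    rw [ih]
    by_contra hne
    obtain ⟨U, V, hU, hV, hxU, hyV, hUV⟩ := t2_separation hne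
    obtain ⟨z, hzU, hzV⟩ := h _ ((hU.preimage hf).mem_nhds hxU) _ ((hV.preimage hf).mem_nhds hyV)
    exact hUV.le_bot ⟨hzU, hzV⟩

theorem existsUnique_chainQuotient_lift {B : Type v} [TopologicalSpace B] [T2Space B]
    {f : M → B} (hf : Continuous f) :
    ∃! g : ChainQuotient M → B, Continuous g ∧ g ∘ chainProj M = f := by
  refine ⟨Quotient.lift f fun x y h => eq_of_chainInseparable_of_continuous hf h,
    ⟨hf.quotient_lift _, rfl⟩, ?_⟩
  rintro g ⟨-, hg⟩
  ext x
  induction x using Quotient.inductionOn with | _ y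
  exact congrFun hg y

end ChainGraph

end OneManifold

theorem theorem1p2 (M : Type u) [TopologicalSpace M] [ConnectedSpace M]
    (hM : OneManifold.IsGraphLike M) (hS : ¬ Nonempty (M ≃ₜ Circle)) :
    OneManifold.IsOpenCWComplexWithVertices (OneManifold.ChainQuotient M)
      (OneManifold.chainProj M '' OneManifold.singularSet M) ∧
    T2Space (OneManifold.ChainQuotient M) ∧
    ∀ (B : Type v) [TopologicalSpace B] [T2Space B] (f : M → B), Continuous f →
      ∃! g : OneManifold.ChainQuotient M → B, Continuous g ∧ g ∘ OneManifold.chainProj M = f := by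
  have hparam : ∀ J : OneManifold.Edges M, Nonempty (OneManifold.ArcParam J.1) := by
    rintro ⟨_, x, hx, rfl⟩
    exact hM.nonempty_arcParam hS hx
  let e : ∀ J : OneManifold.Edges M, OneManifold.ArcParam J.1 := fun J => (hparam J).some
  exact ⟨OneManifold.isOpenCWComplexWithVertices_chainQuotient hM e,
    OneManifold.t2Space_chainQuotient hM e,
    fun B _ _ f hf => OneManifold.existsUnique_chainQuotient_lift hf⟩
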